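/- A weight is a function $\omega:\mathbb C\to[0,\infty)$ that is locally integrable with respect to the Lebesgue area measure $dA$; write $|E|$ for the area of $E$, $\omega(E)=\int_E\omega\,dA$, and $D(u,1)=\{z:|z-u|<1\}$. For $1<p<\infty$ with $\frac1p+\frac1{p'}=1$, a weight $\omega$ belongs to $A_p^{restricted}$ if $\omega>0$ a.e. and, for some $r>0$, $$\sup_{Q}\Big(\frac1{|Q|}\int_Q\omega\,dA\Big)\Big(\frac1{|Q|}\int_Q\omega^{-p'/p}\,dA\Big)^{p/p'}<\infty ,$$ the supremum being over the squares $Q$ of side length $r$ with sides parallel to the axes; it belongs to $A_1^{restricted}$ if $\omega>0$ a.e. and, for some $r>0$, there is $C>0$ with $\omega(Q)/|Q|\le C\,\omega(u)$ for every such square $Q$ and a.e. $u\in Q$. Put $A_\infty^{restricted}=\bigcup_{1\le p<\infty}A_p^{restricted}$. For $0<p,\alpha<\infty$ let $\mathcal F^p_{\alpha,\omega}$ be the space of entire functions $f$ with $\int_{\mathbb C}|f(z)|^pe^{-p\frac{\alpha}{2}|z|^2}\omega(z)\,dA(z)<\infty$, and let $Mult(X,Y)$ be the set of functions $g$ such that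 $gf\in Y$ for every $f\in X$. Let $0<p,q<\infty$, $\alpha,\beta>0$, $\omega\in A_\infty^{restricted}$, and let $\eta$ be a weight. For an entire function $g$ put $$G_g(u)=\frac1{\omega(D(u,1))}\int_{D(u,1)}|g(z)|^qe^{-q\frac{\beta-\alpha}{2}|z|^2}\eta(z)\,dA(z),\qquad u\in\mathbb C .$$ (A) Let $g\in\mathcal F^q_{\beta,\eta}$. (i) If $p\le q$, then $g\in Mult(\mathcal F^p_{\alpha,\omega},\mathcal F^q_{\beta,\eta})$ if and only if there is $C>0$ such that $G_g(u)\le C\,\omega(D(u,1))^{(q-p)/p}$ for all $u\in\mathbb C$. (ii) If $q<p$, then $g\in Mult(\mathcal F^p_{\alpha,\omega},\mathcal F^q_{\beta,\eta})$ if and only if $G_g\in L^{p/(p-q)}(\mathbb C,\omega\,dA)$. (B) (The case $g=1$, without assuming $1\in\mathcal F^q_{\beta,\eta}$.) (i) If $p\le q$, then $\mathcal F^p_{\alpha,\omega}\subset\mathcal F^q_{\beta,\eta}$ if and only if there is $C>0$ such that $G_1(u)\le C\,\omega(D(u,1))^{(q-p)/p}$ for all $u\in\mathbb C$. (ii) If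 $q<p$, then $\mathcal F^p_{\alpha,\omega}\subset\mathcal F^q_{\beta,\eta}$ if and only if $G_1\in L^{p/(p-q)}(\mathbb C,\omega\,dA)$. -/

import Mathlib

open MeasureTheory
open scoped ENNReal

noncomputable section

namespace WeightedFock

/-- A weight on `ℂ`: a nonnegative locally integrable function. -/
def IsWeight (ω : ℂ → ℝ) : Prop :=
  (∀ z, 0 ≤ ω z) ∧ LocallyIntegrable ω volume

/-- The measure `ω dA`, so that `wMeasure ω E` is `ω(E)`. -/
def wMeasure (ω : ℂ → ℝ) : Measure ℂ :=
  volume.withDensity fun z => ENNReal.ofReal (ω z)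

/-- The square of center `z` and side length `r`, with sides parallel to the axes. -/
def square (z : ℂ) (r : ℝ) : Set ℂ :=
  {w | |(w - z).re| ≤ r / 2 ∧ |(w - z).im| ≤ r / 2}

/-- `𝒞_{p,r}(ω)` for `1 < p`, with `p' = p / (p - 1)`: the supremum over all squares of side
length `r` of `(|Q|⁻¹ ∫_Q ω) (|Q|⁻¹ ∫_Q ω^{-p'/p})^{p/p'}`. -/
def apConst (p r : ℝ) (ω : ℂ → ℝ) : ℝ≥0∞ :=
  ⨆ z : ℂ,
    ((∫⁻ w in square z r, ENNReal.ofReal (ω w)) / volume (square z r)) *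
      ((∫⁻ w in square z r, ENNReal.ofReal (ω w) ^ (-(p.conjExponent / p))) /
        volume (square z r)) ^ (p / p.conjExponent)

/-- The class `A_{p,r}` for `1 < p < ∞`. -/
def IsApr (p r : ℝ) (ω : ℂ → ℝ) : Prop :=
  IsWeight ω ∧ (∀ᵐ z, 0 < ω z) ∧ apConst p r ω < ∞

/-- The class `A_{1,r}`. -/
def IsA1r (r : ℝ) (ω : ℂ → ℝ) : Prop :=
  IsWeight ω ∧ (∀ᵐ z, 0 < ω z) ∧
    ∃ C : ℝ, 0 < C ∧ ∀ z : ℂ, ∀ᵐ u, u ∈ square z r →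
      wMeasure ω (square z r) / volume (square z r) ≤ ENNReal.ofReal (C * ω u)

/-- The class `A_p^restricted`, `1 ≤ p < ∞`: `ω` belongs to `A_{p,r}` for some `r > 0`. -/
def IsApRestricted (p : ℝ) (ω : ℂ → ℝ) : Prop :=
  ∃ r : ℝ, 0 < r ∧ ((p = 1 ∧ IsA1r r ω) ∨ (1 < p ∧ IsApr p r ω))

/-- The class `A_∞^restricted`, the union of the classes `A_p^restricted`, `1 ≤ p < ∞`. -/
def IsAInftyRestricted (ω : ℂ → ℝ) : Prop :=
  ∃ p : ℝ, 1 ≤ p ∧ IsApRestricted p ω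

/-- The space `ℒ^p_{α,ω}` of measurable functions `f` with
`∫ |f(z)|^p exp(-p (α/2) |z|²) ω(z) dA(z) < ∞`. -/
def weightedL (p α : ℝ) (ω : ℂ → ℝ) : Set (ℂ → ℂ) :=
  {f | AEStronglyMeasurable f volume ∧
    ∫⁻ z, ENNReal.ofReal (‖f z‖ ^ p * Real.exp (-p * (α / 2) * ‖z‖ ^ 2) * ω z) < ∞}

/-- The weighted Fock space `ℱ^p_{α,ω}` of the entire functions in `ℒ^p_{α,ω}`. -/
def fock (p α : ℝ) (ω : ℂ → ℝ) : Set (ℂ → ℂ) :=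
  weightedL p α ω ∩ {f | Differentiable ℂ f}

/-- The pointwise multipliers from `X` to `Y`. -/
def mult (X Y : Set (ℂ → ℂ)) : Set (ℂ → ℂ) :=
  {g | ∀ f ∈ X, (fun z => g z * f z) ∈ Y}

/-- `G(u) = ω(D(u,1))⁻¹ ∫_{D(u,1)} |g(z)|^q exp(-q ((β-α)/2) |z|²) η(z) dA(z)`. -/
def avg (q α β : ℝ) (ω η : ℂ → ℝ) (g : ℂ → ℂ) (u : ℂ) : ℝ≥0∞ :=
  (∫⁻ z in Metric.ball u 1,
      ENNReal.ofReal (‖g z‖ ^ q * Real.exp (-q * ((β - α) / 2) * ‖z‖ ^ 2) * η z)) /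
    wMeasure ω (Metric.ball u 1)

end WeightedFock

end

open WeightedFock

/-! Put ν = ω dA and let μ have density |g|^q exp(-q(β-α)|z|²/2) η. Splitting β as (β-α)+α shows
that g is a multiplier exactly when every f in the source space satisfies ∫ (|f| exp(-α|z|²/2))^q dμ
< ∞, and G_g(u) is μ(D(u,1))/ν(D(u,1)). So the theorem describes the q-Carleson measures of a
weighted Fock space; the inclusion is the case g = 1.

Everything needed from ω is collected in `Regular`: ν-masses of unit discs vary at most
exponentially with the distance, and |f| exp(-α|z|²/2) to any power has a sub-mean value inequality
against ν. Both follow from the Muckenhoupt condition, tested on indicators of small discs and on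
powers of the Gaussian modulus (`IsAInftyRestricted.regular`).

Sufficiency: the sub-mean value inequality and Fubini replace μ by G ν
(`Regular.exists_lintegral_gauss_le`). What remains is a pointwise bound on f when p ≤ q, and Hölder
when q < p.

Necessity: the test functions are sums of normalized kernels at lattice points, with coefficients
b_n such that b_n^p ν(D_n) is summable. No random signs are needed: the lattice splits into finitely
many residue classes, so sparse that near each point of a class its own kernel dominates all others
(`exists_entire_gauss_comparable`). This works because the coefficients can be taken to vary at most
exponentially, which Gaussian decay beats. Hence ∑ a_n^(q/p) x_n is finite for every summable a,
where x_n = μ(D(n,3))/ν(D(n,1))^(q/p). A superposition argument makes this uniform in a, and duality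
puts x in ℓ^∞ when p ≤ q and in ℓ^(p/(p-q)) when q < p. -/

noncomputable section

namespace WeightedFock

/-! ### Sub-mean value inequalities for Lebesgue measure -/

/-- Sub-mean value property of `‖f‖ ^ s` on circles, for every `s > 0`. -/
lemma norm_rpow_le_circleAverage {f : ℂ → ℂ} (hf : Differentiable ℂ f) {s : ℝ} (hs : 0 < s)
    (c : ℂ) {R : ℝ} (hR : R ≠ 0) :
    ‖f c‖ ^ s ≤ Real.circleAverage (fun z => ‖f z‖ ^ s) c R := by
  have hcont : Continuous fun z => ‖f z‖ ^ s :=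
    hf.continuous.norm.rpow_const fun _ => Or.inr hs.le
  by_cases h0 : f c = 0
  · rw [h0, norm_zero, Real.zero_rpow hs.ne']
    exact Real.circleAverage_nonneg_of_nonneg fun z _ => by positivity
  have hc : 0 < ‖f c‖ := norm_pos_iff.2 h0
  -- Jensen's formula controls log|f|. The passage to powers uses the tangent line bound e·s·log x ≤
  -- x^s, an equality at x = e^(1/s); scaling f to have this modulus at the center makes the bound
  -- lossless there.
  set t : ℝ := Real.exp (1 / s) / ‖f c‖ with ht
  have ht0 : 0 < t := by positivity
  set g : ℂ → ℂ := fun z => (t : ℂ) * f z with hg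
  have hgd : Differentiable ℂ g := hf.const_mul _
  have hgn : ∀ z, ‖g z‖ = t * ‖f z‖ := fun z => by simp [hg, abs_of_pos ht0]
  have hgc : ‖g c‖ = Real.exp (1 / s) := by rw [hgn, ht]; field_simp
  have hgan : AnalyticOnNhd ℂ g (Metric.closedBall c |R|) :=
    fun z _ => hgd.analyticAt z
  have hgc0 : g c ≠ 0 := by rw [← norm_pos_iff, hgc]; positivity
  have hjen := AnalyticOnNhd.circleAverage_log_norm hR hgan hgc0
  have hlog : Real.log ‖g c‖ ≤ Real.circleAverage (Real.log ‖g ·‖) c R := by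
    rw [hjen, le_add_iff_nonneg_left]
    refine finsum_nonneg fun u => ?_
    by_cases hu : u ∈ Metric.closedBall c |R|
    · refine mul_nonneg ?_ ?_
      · exact_mod_cast MeromorphicOn.AnalyticOnNhd.divisor_nonneg hgan u
      · rw [← Real.log_abs]
        by_cases hcu : c = u
        · simp [hcu]
        refine Real.log_nonneg ?_
        rw [abs_mul, abs_inv, abs_norm, ← div_eq_mul_inv, one_le_div]
        · rw [Metric.mem_closedBall, dist_comm, dist_eq_norm] at hu
          exact hu
        · exact norm_pos_iff.2 (sub_ne_zero.2 hcu)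
    · simp [hu]
  rw [hgc, Real.log_exp] at hlog
  have hpt : ∀ z, Real.exp 1 * s * Real.log ‖g z‖ ≤ ‖g z‖ ^ s := fun z => by
    rcases (norm_nonneg (g z)).eq_or_lt with h | h
    · rw [← h]; simp [Real.zero_rpow hs.ne']
    · rw [Real.rpow_def_of_pos h]
      have := Real.add_one_le_exp (Real.log ‖g z‖ * s - 1)
      rw [Real.exp_sub, le_div_iff₀ (Real.exp_pos 1)] at this
      linarith
  have hint : CircleIntegrable (fun z => Real.log ‖g z‖) c R :=
    MeromorphicOn.circleIntegrable_log_norm fun z hz =>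
      (hgan z (Metric.sphere_subset_closedBall hz)).meromorphicAt
  have hcontg : Continuous fun z => ‖g z‖ ^ s :=
    hgd.continuous.norm.rpow_const fun _ => Or.inr hs.le
  have hmono : Real.circleAverage (fun z => (Real.exp 1 * s) • Real.log ‖g z‖) c R ≤
      Real.circleAverage (fun z => ‖g z‖ ^ s) c R :=
    Real.circleAverage_mono (hint.const_smul)
      (hcontg.continuousOn.circleIntegrable') fun z _ => hpt z
  rw [Real.circleAverage_fun_smul] at hmono
  have hgs : (fun z => ‖g z‖ ^ s) = fun z => (t ^ s) • ‖f z‖ ^ s := by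
    funext z
    rw [hgn, Real.mul_rpow ht0.le (norm_nonneg _), smul_eq_mul]
  rw [hgs, Real.circleAverage_fun_smul] at hmono
  have hts : t ^ s * ‖f c‖ ^ s = Real.exp 1 := by
    rw [← Real.mul_rpow ht0.le hc.le, ← hgn, hgc, ← Real.exp_mul]
    congr 1; field_simp
  have hfin : t ^ s * ‖f c‖ ^ s ≤ t ^ s * Real.circleAverage (fun z => ‖f z‖ ^ s) c R := by
    rw [hts]
    refine le_trans ?_ hmono
    rw [smul_eq_mul]
    calc Real.exp 1 = Real.exp 1 * s * (1 / s) := by field_simp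
      _ ≤ _ := by gcongr
  exact le_of_mul_le_mul_left hfin (by positivity)

/-- The circle estimate in terms of the lower integral over angles. -/
lemma enorm_rpow_le_lintegral_circle {f : ℂ → ℂ} (hf : Differentiable ℂ f) {s : ℝ} (hs : 0 < s)
    {R : ℝ} (hR : R ≠ 0) :
    ENNReal.ofReal (2 * Real.pi) * ‖f 0‖ₑ ^ s ≤
      ∫⁻ θ in Set.Ioo (-Real.pi) Real.pi, ‖f (circleMap 0 R θ)‖ₑ ^ s := by
  have hpi := Real.pi_pos
  have hcont : Continuous fun θ => ‖f (circleMap 0 R θ)‖ ^ s :=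
    (hf.continuous.comp (continuous_circleMap 0 R)).norm.rpow_const fun _ => Or.inr hs.le
  have key := norm_rpow_le_circleAverage hf hs 0 hR
  rw [Real.circleAverage_def, smul_eq_mul, inv_mul_eq_div, le_div_iff₀ (by positivity)] at key
  have hper : Function.Periodic (fun θ => ‖f (circleMap 0 R θ)‖ ^ s) (2 * Real.pi) := fun θ => by
    simp only [periodic_circleMap 0 R θ]
  have hshift := hper.intervalIntegral_add_eq 0 (-Real.pi)
  rw [zero_add, show -Real.pi + 2 * Real.pi = Real.pi by ring] at hshift
  rw [hshift, intervalIntegral.integral_of_le (by linarith)] at key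
  have hrw : ∀ z, ‖f z‖ₑ ^ s = ENNReal.ofReal (‖f z‖ ^ s) := fun z => by
    rw [← ofReal_norm, ENNReal.ofReal_rpow_of_nonneg (norm_nonneg _) hs.le]
  simp_rw [hrw]
  rw [restrict_Ioo_eq_restrict_Ioc, ← ofReal_integral_eq_lintegral_ofReal,
    ← ENNReal.ofReal_mul (by positivity), mul_comm]
  · exact ENNReal.ofReal_le_ofReal key
  · exact (hcont.integrableOn_Icc).mono_set Set.Ioc_subset_Icc_self
  · exact Filter.Eventually.of_forall fun θ => by positivity

/-- Sub-mean value property of `‖f‖ ^ s` on discs, with a nonoptimal constant. -/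
lemma enorm_rpow_zero_le_lintegral_ball {f : ℂ → ℂ} (hf : Differentiable ℂ f) {s : ℝ} (hs : 0 < s)
    {δ : ℝ} (hδ : 0 < δ) :
    ENNReal.ofReal (δ / 2) * ENNReal.ofReal (δ / 2) * ENNReal.ofReal (2 * Real.pi) * ‖f 0‖ₑ ^ s ≤
      ∫⁻ z in Metric.ball 0 δ, ‖f z‖ₑ ^ s := by
  have hmeas : Measurable fun z => ‖f z‖ₑ ^ s := hf.continuous.measurable.enorm.pow_const s
  rw [← lintegral_indicator Metric.isOpen_ball.measurableSet,
    ← Complex.lintegral_comp_polarCoord_symm]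
  -- Only the outer annulus is kept: there the polar Jacobian is at least δ/2.
  have hsub : Set.Ioo (δ / 2) δ ×ˢ Set.Ioo (-Real.pi) Real.pi ⊆ polarCoord.target := by
    rintro ⟨ρ, θ⟩ ⟨h1, h2⟩
    exact ⟨lt_trans (half_pos hδ) h1.1, h2⟩
  refine le_trans ?_ (lintegral_mono_set hsub)
  have hle : ∀ p ∈ Set.Ioo (δ / 2) δ ×ˢ Set.Ioo (-Real.pi) Real.pi,
      ENNReal.ofReal (δ / 2) * ‖f (circleMap 0 p.1 p.2)‖ₑ ^ s ≤
      ENNReal.ofReal p.1 • (Metric.ball (0 : ℂ) δ).indicator (fun z => ‖f z‖ₑ ^ s)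
        (Complex.polarCoord.symm p) := by
    rintro ⟨ρ, θ⟩ ⟨h1, h2⟩
    have hρ : 0 < ρ := lt_trans (half_pos hδ) h1.1
    have hcm : Complex.polarCoord.symm (ρ, θ) = circleMap 0 ρ θ := by
      rw [Complex.polarCoord_symm_apply, circleMap_zero, Complex.exp_mul_I]
      push_cast; rfl
    rw [hcm, Set.indicator_of_mem, smul_eq_mul]
    · gcongr
      exact h1.1.le
    · simp [abs_of_pos hρ, h1.2]
  refine le_trans ?_ (setLIntegral_mono' (measurableSet_Ioo.prod measurableSet_Ioo) hle)
  rw [Measure.volume_eq_prod, ← Measure.prod_restrict, lintegral_prod]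
  · have hin : ∀ ρ ∈ Set.Ioo (δ / 2) δ,
        ENNReal.ofReal (δ / 2) * (ENNReal.ofReal (2 * Real.pi) * ‖f 0‖ₑ ^ s) ≤
        ∫⁻ θ in Set.Ioo (-Real.pi) Real.pi,
          ENNReal.ofReal (δ / 2) * ‖f (circleMap 0 ρ θ)‖ₑ ^ s := fun ρ hρ => by
      rw [lintegral_const_mul]
      · gcongr
        exact enorm_rpow_le_lintegral_circle hf hs (lt_trans (half_pos hδ) hρ.1).ne'
      · exact hmeas.comp (continuous_circleMap 0 ρ).measurable
    refine le_trans ?_ (setLIntegral_mono' measurableSet_Ioo hin)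
    rw [setLIntegral_const, Real.volume_Ioo, show δ - δ / 2 = δ / 2 by ring]
    apply le_of_eq; ring
  · refine Measurable.aemeasurable (Measurable.const_mul (hmeas.comp ?_) _)
    unfold circleMap
    fun_prop

/-- The modulus of `f` with respect to the Gaussian of parameter `α`. -/
def gauss (α : ℝ) (f : ℂ → ℂ) (z : ℂ) : ℝ≥0∞ :=
  ‖f z‖ₑ * ENNReal.ofReal (Real.exp (-(α / 2) * ‖z‖ ^ 2))

lemma measurable_gauss (α : ℝ) {f : ℂ → ℂ} (hf : Continuous f) : Measurable (gauss α f) :=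
  hf.measurable.enorm.mul (by fun_prop : Measurable fun z : ℂ =>
    Real.exp (-(α / 2) * ‖z‖ ^ 2)).ennreal_ofReal

/-- Sub-mean value property for the Gaussian modulus. -/
lemma exists_gauss_rpow_le (α : ℝ) (hα : 0 < α) {s δ : ℝ} (hs : 0 < s) (hδ : 0 < δ) :
    ∃ C : ℝ≥0∞, C ≠ ∞ ∧ ∀ f : ℂ → ℂ, Differentiable ℂ f → ∀ z,
      gauss α f z ^ s ≤ C * ∫⁻ w in Metric.ball z δ, gauss α f w ^ s := by
  set K := ENNReal.ofReal (δ / 2) * ENNReal.ofReal (δ / 2) * ENNReal.ofReal (2 * Real.pi) with hK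
  have hK0 : K ≠ 0 := by
    have := Real.pi_pos
    simp only [hK, ne_eq, mul_eq_zero, ENNReal.ofReal_eq_zero, not_or, not_le]
    refine ⟨⟨?_, ?_⟩, ?_⟩ <;> positivity
  have hKt : K ≠ ∞ := by rw [hK]; finiteness
  set E := ENNReal.ofReal (Real.exp (α / 2 * δ ^ 2)) ^ s with hE
  have hEt : E ≠ ∞ := ENNReal.rpow_ne_top_of_nonneg hs.le ENNReal.ofReal_ne_top
  refine ⟨K⁻¹ * E, ENNReal.mul_ne_top (ENNReal.inv_ne_top.2 hK0) hEt, fun f hf z => ?_⟩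
  -- Translation twisted by an exponential: the cross term of |z+ζ|² is absorbed into the entire
  -- function h, so the estimate at 0 transfers to z with a constant independent of z.
  set h : ℂ → ℂ := fun ζ => f (z + ζ) * Complex.exp (-(α * (starRingEnd ℂ z) * ζ)) with hh
  have hhd : Differentiable ℂ h := by
    have : Differentiable ℂ fun ζ => f (z + ζ) := hf.comp (by fun_prop)
    exact this.mul (by fun_prop)
  have hgh : ∀ ζ, gauss α f (z + ζ) = ‖h ζ‖ₑ *
      ENNReal.ofReal (Real.exp (-(α / 2) * ‖z‖ ^ 2) * Real.exp (-(α / 2) * ‖ζ‖ ^ 2)) := fun ζ => by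
    rw [gauss, hh, enorm_mul, mul_assoc, ← ofReal_norm (Complex.exp _),
      ← ENNReal.ofReal_mul (norm_nonneg _), Complex.norm_exp, ← Real.exp_add, ← Real.exp_add]
    congr 3
    rw [← Complex.normSq_eq_norm_sq, ← Complex.normSq_eq_norm_sq, ← Complex.normSq_eq_norm_sq,
      Complex.normSq_add]
    simp [Complex.normSq_apply]
    ring
  have hmean := enorm_rpow_zero_le_lintegral_ball hhd hs hδ
  rw [← hK] at hmean
  set e := ENNReal.ofReal (Real.exp (-(α / 2) * ‖z‖ ^ 2)) with he
  have h1 : gauss α f z ^ s = ‖h 0‖ₑ ^ s * e ^ s := by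
    have := hgh 0
    rw [add_zero] at this
    rw [this, ENNReal.mul_rpow_of_nonneg _ _ hs.le]
    simp [he]
  have h2 : ∀ ζ ∈ Metric.ball (0 : ℂ) δ, ‖h ζ‖ₑ ^ s * e ^ s ≤ E * gauss α f (z + ζ) ^ s := by
    intro ζ hζ
    rw [hgh, hE, ← ENNReal.mul_rpow_of_nonneg _ _ hs.le, ← ENNReal.mul_rpow_of_nonneg _ _ hs.le,
      mul_left_comm]
    refine ENNReal.rpow_le_rpow (mul_le_mul_right ?_ _) hs.le
    rw [← ENNReal.ofReal_mul (by positivity), he]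
    refine ENNReal.ofReal_le_ofReal ?_
    rw [← Real.exp_add, ← Real.exp_add, Real.exp_le_exp]
    have h3 : ‖ζ‖ ^ 2 ≤ δ ^ 2 := by
      have : ‖ζ‖ < δ := by simpa using hζ
      gcongr
    nlinarith
  have hball : ∫⁻ w in Metric.ball z δ, gauss α f w ^ s =
      ∫⁻ ζ in Metric.ball (0 : ℂ) δ, gauss α f (z + ζ) ^ s := by
    have hmp : MeasurePreserving (fun ζ : ℂ => z + ζ) := measurePreserving_add_left volume z
    rw [← hmp.setLIntegral_comp_preimage_emb (MeasurableEquiv.addLeft z).measurableEmbedding]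
    congr 2
    ext ζ
    simp [dist_eq_norm]
  rw [h1, mul_assoc, hball, ← lintegral_const_mul' _ _ hEt]
  calc ‖h 0‖ₑ ^ s * e ^ s = K⁻¹ * (K * ‖h 0‖ₑ ^ s * e ^ s) := by
        rw [← mul_assoc, ← mul_assoc, ENNReal.inv_mul_cancel hK0 hKt, one_mul]
    _ ≤ K⁻¹ * ((∫⁻ ζ in Metric.ball (0 : ℂ) δ, ‖h ζ‖ₑ ^ s) * e ^ s) := by gcongr
    _ = K⁻¹ * ∫⁻ ζ in Metric.ball (0 : ℂ) δ, ‖h ζ‖ₑ ^ s * e ^ s := by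
        rw [lintegral_mul_const' _ _ (ENNReal.rpow_ne_top_of_nonneg hs.le ENNReal.ofReal_ne_top)]
    _ ≤ _ := by
        gcongr K⁻¹ * ?_
        exact setLIntegral_mono' Metric.isOpen_ball.measurableSet h2

/-! ### Restricted Muckenhoupt conditions as averaging bounds -/

lemma isClosed_square (z : ℂ) (r : ℝ) : IsClosed (square z r) := by
  have : square z r = {w : ℂ | |(w - z).re| ≤ r / 2} ∩ {w : ℂ | |(w - z).im| ≤ r / 2} := rfl
  rw [this]
  exact (isClosed_le (by fun_prop) continuous_const).inter
    (isClosed_le (by fun_prop) continuous_const)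

lemma square_subset_closedBall (z : ℂ) (r : ℝ) : square z r ⊆ Metric.closedBall z r := by
  rintro w ⟨h1, h2⟩
  rw [Metric.mem_closedBall, dist_eq_norm]
  exact (Complex.norm_le_abs_re_add_abs_im _).trans (by linarith)

lemma ball_subset_square {z z' : ℂ} {r δ : ℝ} (h : δ + dist z z' ≤ r / 2) :
    Metric.ball z' δ ⊆ square z r := by
  intro w hw
  have hwz : ‖w - z‖ ≤ r / 2 := by
    rw [← dist_eq_norm]
    have := dist_triangle w z' z
    rw [dist_comm z' z] at this
    linarith [Metric.mem_ball.1 hw]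
  exact ⟨(Complex.abs_re_le_norm _).trans hwz, (Complex.abs_im_le_norm _).trans hwz⟩

lemma volume_square_eq (z : ℂ) (r : ℝ) : volume (square z r) = volume (square 0 r) := by
  rw [← measure_preimage_add volume z (square z r)]
  congr 1
  ext w
  simp [square]

lemma volume_square_ne_top (z : ℂ) (r : ℝ) : volume (square z r) ≠ ∞ :=
  ((measure_mono (square_subset_closedBall z r)).trans_lt measure_closedBall_lt_top).ne

lemma volume_square_ne_zero (z : ℂ) {r : ℝ} (hr : 0 < r) : volume (square z r) ≠ 0 :=
  ((Metric.measure_ball_pos volume z (half_pos hr)).trans_le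
    (measure_mono (ball_subset_square (by simp)))).ne'

/-- A form of the restricted Muckenhoupt conditions common to all exponents. -/
def AveragingBound (a r : ℝ) (C : ℝ≥0∞) (ν : Measure ℂ) : Prop :=
  ∀ z, ∀ F : ℂ → ℝ≥0∞, Measurable F →
    (∫⁻ w in square z r, F w) ^ a * ν (square z r) ≤ C * ∫⁻ w in square z r, F w ^ a ∂ν

lemma IsWeight.aemeasurable_ofReal {ω : ℂ → ℝ} (h : IsWeight ω) :
    AEMeasurable (fun z => ENNReal.ofReal (ω z)) :=
  h.2.aestronglyMeasurable.aemeasurable.ennreal_ofReal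

lemma IsWeight.setLIntegral_wMeasure {ω : ℂ → ℝ} (h : IsWeight ω) {F : ℂ → ℝ≥0∞}
    {E : Set ℂ} (hE : MeasurableSet E) :
    ∫⁻ w in E, F w ∂(wMeasure ω) = ∫⁻ w in E, ENNReal.ofReal (ω w) * F w := by
  rw [wMeasure, setLIntegral_withDensity_eq_setLIntegral_mul_non_measurable₀ _
    h.aemeasurable_ofReal.restrict _ hE (Filter.Eventually.of_forall fun _ => ENNReal.ofReal_lt_top)]
  rfl

/-- The A₁ inequality ω(Q) ≤ C |Q| ω(u), multiplied by F(u) and integrated over Q. -/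
lemma IsA1r.averagingBound {r : ℝ} {ω : ℂ → ℝ} (h : IsA1r r ω) (hr : 0 < r) :
    ∃ C : ℝ≥0∞, C ≠ ∞ ∧ AveragingBound 1 r C (wMeasure ω) := by
  obtain ⟨hw, -, C, hC, h⟩ := h
  refine ⟨volume (square 0 r) * ENNReal.ofReal C,
    ENNReal.mul_ne_top (volume_square_ne_top _ _) ENNReal.ofReal_ne_top, fun z F hF => ?_⟩
  have hm := (isClosed_square z r).measurableSet
  simp only [ENNReal.rpow_one]
  rw [← lintegral_mul_const _ hF, hw.setLIntegral_wMeasure hm, ← lintegral_const_mul' _ _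
    (ENNReal.mul_ne_top (volume_square_ne_top _ _) ENNReal.ofReal_ne_top), ← volume_square_eq z]
  refine setLIntegral_mono_ae' hm ?_
  filter_upwards [h z] with u hu huQ
  have h1 := hu huQ
  rw [ENNReal.div_le_iff (volume_square_ne_zero z hr) (volume_square_ne_top z r),
    ENNReal.ofReal_mul hC.le] at h1
  calc F u * wMeasure ω (square z r)
      ≤ F u * (ENNReal.ofReal C * ENNReal.ofReal (ω u) * volume (square z r)) := by gcongr
    _ = _ := by ring

/-- Hölder for F = (F ω^(1/p)) · ω^(-1/p): after raising to the power p, the second factor times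
ω(Q) is the A_p product up to powers of |Q|, which is the same for all squares of side r. -/
lemma IsApr.averagingBound {p r : ℝ} {ω : ℂ → ℝ} (h : IsApr p r ω) (hp : 1 < p) (hr : 0 < r) :
    ∃ C : ℝ≥0∞, C ≠ ∞ ∧ AveragingBound p r C (wMeasure ω) := by
  obtain ⟨hw, hpos, hA⟩ := h
  set p' := p.conjExponent with hp'
  have hpq : p.HolderConjugate p' := Real.HolderConjugate.conjExponent hp
  have hp0 : 0 < p := hpq.pos
  have hp'0 : 0 < p' := hpq.symm.pos
  have hQ0 := fun z => volume_square_ne_zero z hr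
  have hQt := fun z => volume_square_ne_top z r
  have hk : 0 ≤ p / p' := by positivity
  refine ⟨apConst p r ω * (volume (square 0 r) * volume (square 0 r) ^ (p / p')),
    ENNReal.mul_ne_top hA.ne (ENNReal.mul_ne_top (hQt 0)
      (ENNReal.rpow_ne_top_of_nonneg hk (hQt 0))), fun z F hF => ?_⟩
  have hm := (isClosed_square z r).measurableSet
  set Q := square z r with hQ
  set o : ℂ → ℝ≥0∞ := fun w => ENNReal.ofReal (ω w) with ho
  have hom : AEMeasurable o := hw.aemeasurable_ofReal
  set J := ∫⁻ w in Q, o w ^ (-(p' / p)) with hJ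
  have hI : wMeasure ω Q = ∫⁻ w in Q, o w := by rw [wMeasure, withDensity_apply _ hm]
  have hAz : (wMeasure ω Q / volume Q) * (J / volume Q) ^ (p / p') ≤ apConst p r ω := by
    rw [hI]
    exact le_iSup (fun z => ((∫⁻ w in square z r, ENNReal.ofReal (ω w)) / volume (square z r)) *
      ((∫⁻ w in square z r, ENNReal.ofReal (ω w) ^ (-(p.conjExponent / p))) /
        volume (square z r)) ^ (p / p.conjExponent)) z
  have hIJ : wMeasure ω Q * J ^ (p / p') ≤
      apConst p r ω * (volume (square 0 r) * volume (square 0 r) ^ (p / p')) := by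
    rw [← volume_square_eq z]
    calc wMeasure ω Q * J ^ (p / p')
        = (wMeasure ω Q / volume Q * volume Q) * (J / volume Q * volume Q) ^ (p / p') := by
          rw [ENNReal.div_mul_cancel (hQ0 z) (hQt z), ENNReal.div_mul_cancel (hQ0 z) (hQt z)]
      _ = (wMeasure ω Q / volume Q) * (J / volume Q) ^ (p / p') *
            (volume Q * volume Q ^ (p / p')) := by
          rw [ENNReal.mul_rpow_of_nonneg _ _ hk]; ring
      _ ≤ _ := by gcongr
  have hholder : ∫⁻ w in Q, F w ≤ (∫⁻ w in Q, o w * F w ^ p) ^ (1 / p) * J ^ (1 / p') := by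
    have h1 := ENNReal.lintegral_mul_le_Lp_mul_Lq (volume.restrict Q) hpq
      (f := fun w => F w * o w ^ (1 / p)) (g := fun w => o w ^ (-(1 / p)))
      (hF.aemeasurable.mul (hom.restrict.pow_const _)) (hom.restrict.pow_const _)
    have h2 : ∫⁻ w in Q, F w =
        ∫⁻ w in Q, ((fun w => F w * o w ^ (1 / p)) * fun w => o w ^ (-(1 / p))) w := by
      refine lintegral_congr_ae (ae_restrict_of_ae ?_)
      filter_upwards [hpos] with w hw
      have h0 : o w ≠ 0 := by simpa [ho] using hw
      simp only [Pi.mul_apply]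
      rw [mul_assoc, ← ENNReal.rpow_add _ _ h0 ENNReal.ofReal_ne_top]
      simp
    rw [h2]
    refine h1.trans (le_of_eq ?_)
    congr 2
    · refine lintegral_congr fun w => ?_
      rw [ENNReal.mul_rpow_of_nonneg _ _ hp0.le, ← ENNReal.rpow_mul, one_div_mul_cancel hp0.ne',
        ENNReal.rpow_one, mul_comm]
    · refine lintegral_congr fun w => ?_
      rw [← ENNReal.rpow_mul]
      congr 1; ring
  rw [hw.setLIntegral_wMeasure hm]
  calc (∫⁻ w in Q, F w) ^ p * wMeasure ω Q
      ≤ ((∫⁻ w in Q, o w * F w ^ p) ^ (1 / p) * J ^ (1 / p')) ^ p * wMeasure ω Q := by gcongr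
    _ = (wMeasure ω Q * J ^ (p / p')) * ∫⁻ w in Q, o w * F w ^ p := by
      rw [ENNReal.mul_rpow_of_nonneg _ _ hp0.le, ← ENNReal.rpow_mul, one_div_mul_cancel hp0.ne',
        ENNReal.rpow_one, ← ENNReal.rpow_mul, one_div_mul_eq_div]
      ring
    _ ≤ _ := by gcongr

lemma IsAInftyRestricted.isWeight {ω : ℂ → ℝ} (h : IsAInftyRestricted ω) :
    IsWeight ω ∧ ∀ᵐ z, 0 < ω z := by
  obtain ⟨p, -, r, -, ⟨-, h⟩ | ⟨-, h⟩⟩ := h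
  exacts [⟨h.1, h.2.1⟩, ⟨h.1, h.2.1⟩]

lemma IsAInftyRestricted.exists_averagingBound {ω : ℂ → ℝ} (h : IsAInftyRestricted ω) :
    ∃ a r : ℝ, ∃ C : ℝ≥0∞, 0 < a ∧ 0 < r ∧ C ≠ ∞ ∧ AveragingBound a r C (wMeasure ω) := by
  obtain ⟨p, -, r, hr, ⟨-, h⟩ | ⟨hp, h⟩⟩ := h
  · obtain ⟨C, hC, hb⟩ := h.averagingBound hr
    exact ⟨1, r, C, one_pos, hr, hC, hb⟩
  · obtain ⟨C, hC, hb⟩ := h.averagingBound hp hr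
    exact ⟨p, r, C, one_pos.trans hp, hr, hC, hb⟩

/-! ### Regularity of the measure ω dA -/

lemma IsWeight.wMeasure_ball_ne_top {ω : ℂ → ℝ} (h : IsWeight ω) (z : ℂ) (ρ : ℝ) :
    wMeasure ω (Metric.ball z ρ) ≠ ∞ := by
  rw [wMeasure, withDensity_apply _ Metric.isOpen_ball.measurableSet]
  have : IntegrableOn ω (Metric.ball z ρ) :=
    (h.2.integrableOn_isCompact (isCompact_closedBall z ρ)).mono_set Metric.ball_subset_closedBall
  exact this.lintegral_lt_top.ne

lemma wMeasure_ball_ne_zero {ω : ℂ → ℝ} (hw : IsWeight ω) (h : ∀ᵐ z, 0 < ω z) (z : ℂ) {ρ : ℝ}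
    (hρ : 0 < ρ) : wMeasure ω (Metric.ball z ρ) ≠ 0 := by
  rw [wMeasure, withDensity_apply _ Metric.isOpen_ball.measurableSet]
  intro h0
  rw [lintegral_eq_zero_iff' hw.aemeasurable_ofReal.restrict] at h0
  have hf : ∀ᵐ w ∂(volume.restrict (Metric.ball z ρ)), False := by
    filter_upwards [h0, ae_restrict_of_ae h] with w h1 h2
    simp only [Pi.zero_apply, ENNReal.ofReal_eq_zero] at h1
    linarith
  rw [Filter.eventually_false_iff_eq_bot, ae_eq_bot, Measure.restrict_eq_zero] at hf
  exact (Metric.measure_ball_pos volume z hρ).ne' hf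

/-- Doubling at the fixed scale r: the averaging bound is tested on the indicator of the small disc,
whose area does not depend on its center. -/
lemma AveragingBound.square_le_ball {a r δ : ℝ} {C : ℝ≥0∞} {ν : Measure ℂ}
    (h : AveragingBound a r C ν) (ha : 0 < a) (hC : C ≠ ∞) (hδ : 0 < δ) (hδr : δ ≤ r / 4) :
    ∃ K : ℝ≥0∞, K ≠ ∞ ∧ ∀ z z' : ℂ, dist z z' ≤ r / 4 →
      ν (square z r) ≤ K * ν (Metric.ball z' δ) := by
  set B := volume (Metric.ball (0 : ℂ) δ) with hB
  have hB0 : B ≠ 0 := (Metric.measure_ball_pos volume 0 hδ).ne'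
  have hBt : B ≠ ∞ := measure_ball_lt_top.ne
  have hBa0 : B ^ a ≠ 0 := by simp [ENNReal.rpow_eq_zero_iff, hB0, hBt]
  have hBat : B ^ a ≠ ∞ := ENNReal.rpow_ne_top_of_nonneg ha.le hBt
  refine ⟨(B ^ a)⁻¹ * C, ENNReal.mul_ne_top (ENNReal.inv_ne_top.2 hBa0) hC, fun z z' hz => ?_⟩
  have hsub : Metric.ball z' δ ⊆ square z r := ball_subset_square (by linarith)
  have hbm : MeasurableSet (Metric.ball z' δ) := Metric.isOpen_ball.measurableSet
  have h1 := h z ((Metric.ball z' δ).indicator 1) (measurable_one.indicator hbm)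
  have h2 : ∫⁻ w in square z r, (Metric.ball z' δ).indicator 1 w = B := by
    rw [lintegral_indicator_one hbm, Measure.restrict_apply hbm, Set.inter_eq_left.2 hsub, hB,
      Measure.addHaar_ball_center]
  have h3 : ∫⁻ w in square z r, (Metric.ball z' δ).indicator (1 : ℂ → ℝ≥0∞) w ^ a ∂ν =
      ν (Metric.ball z' δ) := by
    have : (fun w => (Metric.ball z' δ).indicator (1 : ℂ → ℝ≥0∞) w ^ a) =
        (Metric.ball z' δ).indicator 1 := by
      funext w
      by_cases hw : w ∈ Metric.ball z' δ <;> simp [hw, ha]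
    rw [this, lintegral_indicator_one hbm, Measure.restrict_apply hbm, Set.inter_eq_left.2 hsub]
  rw [h2, h3] at h1
  calc ν (square z r) = (B ^ a)⁻¹ * (B ^ a * ν (square z r)) := by
        rw [← mul_assoc, ENNReal.inv_mul_cancel hBa0 hBat, one_mul]
    _ ≤ (B ^ a)⁻¹ * (C * ν (Metric.ball z' δ)) := by gcongr
    _ = _ := by ring

/-- A function that changes by a bounded factor at distance `ρ` grows at most exponentially. -/
lemma exists_exp_growth {S : ℂ → ℝ≥0∞} {K : ℝ≥0∞} {ρ : ℝ} (hρ : 0 < ρ) (hK : K ≠ ∞)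
    (h : ∀ z z', dist z z' ≤ ρ → S z ≤ K * S z') :
    ∃ L c : ℝ, 0 ≤ c ∧ ∀ z z', S z ≤ ENNReal.ofReal (Real.exp (L + c * dist z z')) * S z' := by
  -- A chain of n steps of length at most ρ along the segment from z to z'. The factor K + 1
  -- replaces K so that its logarithm is nonnegative.
  have hstep : ∀ n : ℕ, ∀ z z', dist z z' ≤ n * ρ → S z ≤ (K + 1) ^ n * S z' := by
    intro n
    induction n with
    | zero =>
      intro z z' hz
      have : z = z' := dist_le_zero.1 (by simpa using hz)
      simp [this]
    | succ n ih =>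
      intro z z' hz
      set w : ℂ := AffineMap.lineMap z z' ((n : ℝ) / (n + 1)) with hw
      have hn : (0 : ℝ) < n + 1 := by positivity
      push_cast at hz
      have h1 : dist z w ≤ n * ρ := by
        rw [hw, dist_left_lineMap, Real.norm_of_nonneg (by positivity), div_mul_eq_mul_div,
          div_le_iff₀ hn]
        have : (0 : ℝ) ≤ n := by positivity
        nlinarith
      have h2 : dist w z' ≤ ρ := by
        rw [hw, dist_lineMap_right, show (1 : ℝ) - n / (n + 1) = 1 / (n + 1) by field_simp; ring,
          Real.norm_of_nonneg (by positivity), div_mul_eq_mul_div, div_le_iff₀ hn]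
        linarith
      calc S z ≤ (K + 1) ^ n * S w := ih z w h1
        _ ≤ (K + 1) ^ n * (K * S z') := by gcongr; exact h w z' h2
        _ ≤ (K + 1) ^ n * ((K + 1) * S z') := by gcongr; exact le_self_add
        _ = _ := by ring
  set L := Real.log (K + 1).toReal with hL
  have hKt : K + 1 ≠ ∞ := by finiteness
  have hK1 : 1 ≤ (K + 1).toReal := by
    rw [← ENNReal.ofReal_le_iff_le_toReal hKt]; simp
  have hL0 : 0 ≤ L := Real.log_nonneg hK1
  have hKL : K + 1 = ENNReal.ofReal (Real.exp L) := by
    rw [hL, Real.exp_log (by linarith), ENNReal.ofReal_toReal hKt]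
  refine ⟨L, L / ρ, by positivity, fun z z' => ?_⟩
  refine (hstep ⌈dist z z' / ρ⌉₊ z z' ?_).trans ?_
  · rw [← div_le_iff₀ hρ]; exact Nat.le_ceil _
  · gcongr
    rw [hKL, ← ENNReal.ofReal_pow (by positivity), ← Real.exp_nat_mul]
    gcongr
    have := (Nat.ceil_lt_add_one (show 0 ≤ dist z z' / ρ by positivity)).le
    calc (⌈dist z z' / ρ⌉₊ : ℝ) * L ≤ (dist z z' / ρ + 1) * L := by gcongr
      _ = _ := by ring

/-- The two properties of a measure used below: masses of unit discs grow at most exponentially,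
and Gaussian moduli of entire functions satisfy sub-mean value estimates. -/
structure Regular (ν : Measure ℂ) : Prop where
  ne_top : ∀ z, ν (Metric.ball z 1) ≠ ∞
  ne_zero : ∀ z, ν (Metric.ball z 1) ≠ 0
  growth : ∃ L c : ℝ, 0 ≤ c ∧ ∀ z z', ν (Metric.ball z 1) ≤
    ENNReal.ofReal (Real.exp (L + c * dist z z')) * ν (Metric.ball z' 1)
  submean : ∀ α s : ℝ, 0 < α → 0 < s → ∃ C : ℝ≥0∞, C ≠ ∞ ∧ ∀ f : ℂ → ℂ, Differentiable ℂ f → ∀ z,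
    gauss α f z ^ s * ν (Metric.ball z 1) ≤ C * ∫⁻ w in Metric.ball z 1, gauss α f w ^ s ∂ν

/-- The scale r of the squares is unrelated to 1. Masses of unit discs and r-squares are comparable:
a small disc lies in both, and boundedly many translated squares cover a unit disc. Growth then
passes from squares to discs. -/
lemma IsAInftyRestricted.regular {ω : ℂ → ℝ} (h : IsAInftyRestricted ω) :
    Regular (wMeasure ω) := by
  obtain ⟨hw, hpos⟩ := h.isWeight
  obtain ⟨a, r, C, ha, hr, hC, hb⟩ := h.exists_averagingBound
  set ν := wMeasure ω with hν
  set δ := min (r / 4) 1 with hδ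
  have hδ0 : 0 < δ := lt_min (by positivity) one_pos
  have hδr : δ ≤ r / 4 := min_le_left _ _
  have hδ1 : δ ≤ 1 := min_le_right _ _
  obtain ⟨K, hK, hKb⟩ := hb.square_le_ball ha hC hδ0 hδr
  have hSS : ∀ z z', dist z z' ≤ r / 4 → ν (square z r) ≤ K * ν (square z' r) := fun z z' hz =>
    (hKb z z' hz).trans (mul_le_mul_right (measure_mono (ball_subset_square
      (by rw [dist_self]; linarith))) _)
  have hSV : ∀ z, ν (square z r) ≤ K * ν (Metric.ball z 1) := fun z =>
    (hKb z z (by rw [dist_self]; positivity)).trans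
      (mul_le_mul_right (measure_mono (Metric.ball_subset_ball hδ1)) _)
  obtain ⟨L, c, hc, hg⟩ := exists_exp_growth (by positivity) hK hSS
  -- One finite cover of the disc at the origin, translated to every z, makes the number of squares
  -- and their distances to z uniform.
  obtain ⟨T, -, hTf, hT⟩ := (isCompact_closedBall (0 : ℂ) 1).finite_cover_balls
    (show 0 < r / 4 by positivity)
  obtain ⟨M, hM, hVS⟩ : ∃ M : ℝ≥0∞, M ≠ ∞ ∧ ∀ z, ν (Metric.ball z 1) ≤ M * ν (square z r) := by
    refine ⟨∑ s ∈ hTf.toFinset, ENNReal.ofReal (Real.exp (L + c * ‖s‖)),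
      ENNReal.sum_ne_top.2 fun _ _ => ENNReal.ofReal_ne_top, fun z => ?_⟩
    have hcov : Metric.ball z 1 ⊆ ⋃ s ∈ hTf.toFinset, square (z + s) r := by
      intro w hw
      have h1 : w - z ∈ Metric.closedBall (0 : ℂ) 1 := by
        rw [mem_closedBall_zero_iff, ← dist_eq_norm]
        exact (Metric.mem_ball.1 hw).le
      obtain ⟨s, hs, hws⟩ := Set.mem_iUnion₂.1 (hT h1)
      refine Set.mem_iUnion₂.2 ⟨s, by simpa using hs, ?_⟩
      refine ball_subset_square (z' := z + s) (δ := r / 4) (by rw [dist_self]; linarith) ?_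
      rw [Metric.mem_ball, dist_eq_norm] at hws ⊢
      rwa [← sub_sub]
    calc ν (Metric.ball z 1) ≤ ∑ s ∈ hTf.toFinset, ν (square (z + s) r) :=
          (measure_mono hcov).trans (measure_biUnion_finset_le _ _)
      _ ≤ ∑ s ∈ hTf.toFinset, ENNReal.ofReal (Real.exp (L + c * ‖s‖)) * ν (square z r) := by
          gcongr with s hs
          simpa using hg (z + s) z
      _ = _ := by rw [Finset.sum_mul]
  have hM' : M * (K + 1) ≠ ∞ := by finiteness
  have hrM : M * (K + 1) ≤ ENNReal.ofReal (Real.exp (Real.log (max (M * (K + 1)).toReal 1))) := by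
    rw [Real.exp_log (by positivity), ENNReal.le_ofReal_iff_toReal_le hM' (by positivity)]
    exact le_max_left _ _
  refine ⟨fun z => hw.wMeasure_ball_ne_top z 1, fun z => wMeasure_ball_ne_zero hw hpos z one_pos,
    ⟨Real.log (max (M * (K + 1)).toReal 1) + L, c, hc, fun z z' => ?_⟩, fun α s hα hs => ?_⟩
  · calc ν (Metric.ball z 1) ≤ M * ν (square z r) := hVS z
      _ ≤ M * (ENNReal.ofReal (Real.exp (L + c * dist z z')) * ν (square z' r)) := by
          gcongr; exact hg z z'
      _ ≤ M * (ENNReal.ofReal (Real.exp (L + c * dist z z')) *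
            ((K + 1) * ν (Metric.ball z' 1))) := by
          gcongr; exact (hSV z').trans (by gcongr; exact le_self_add)
      _ = (M * (K + 1)) * ENNReal.ofReal (Real.exp (L + c * dist z z')) *
            ν (Metric.ball z' 1) := by ring
      _ ≤ _ := by
          rw [add_assoc, Real.exp_add (Real.log _) (L + _), ENNReal.ofReal_mul (by positivity)]
          gcongr
  -- The exponent s/a is chosen because the averaging bound raises the Lebesgue integral to the
  -- power a, which returns the exponent s. This is why the Lebesgue estimate is needed for
  -- arbitrarily small powers.
  · obtain ⟨D, hD, hDb⟩ := exists_gauss_rpow_le α hα (show 0 < s / a by positivity) hδ0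
    refine ⟨M * (D ^ a * C), ENNReal.mul_ne_top hM (ENNReal.mul_ne_top
      (ENNReal.rpow_ne_top_of_nonneg ha.le hD) hC), fun f hf z => ?_⟩
    have hbm : MeasurableSet (Metric.ball z δ) := Metric.isOpen_ball.measurableSet
    have hsub : Metric.ball z δ ⊆ square z r := ball_subset_square (by rw [dist_self]; linarith)
    set F : ℂ → ℝ≥0∞ := (Metric.ball z δ).indicator fun w => gauss α f w ^ (s / a) with hF
    have hFm : Measurable F := ((measurable_gauss α hf.continuous).pow_const _).indicator hbm
    have h1 := hb z F hFm
    have h2 : ∫⁻ w in square z r, F w = ∫⁻ w in Metric.ball z δ, gauss α f w ^ (s / a) := by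
      rw [hF, lintegral_indicator hbm, Measure.restrict_restrict hbm, Set.inter_eq_left.2 hsub]
    have h3 : ∫⁻ w in square z r, F w ^ a ∂ν ≤ ∫⁻ w in Metric.ball z 1, gauss α f w ^ s ∂ν := by
      have : (fun w => F w ^ a) = (Metric.ball z δ).indicator fun w => gauss α f w ^ s := by
        funext w
        by_cases hw : w ∈ Metric.ball z δ
        · simp only [hF, Set.indicator_of_mem hw]
          rw [← ENNReal.rpow_mul, div_mul_cancel₀ _ ha.ne']
        · simp [hF, Set.indicator_of_notMem hw, ha]
      rw [this, lintegral_indicator hbm, Measure.restrict_restrict hbm, Set.inter_eq_left.2 hsub]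
      exact lintegral_mono_set (Metric.ball_subset_ball hδ1)
    rw [h2] at h1
    calc gauss α f z ^ s * ν (Metric.ball z 1)
        ≤ (gauss α f z ^ (s / a)) ^ a * (M * ν (square z r)) := by
          rw [← ENNReal.rpow_mul, div_mul_cancel₀ _ ha.ne']; gcongr; exact hVS z
      _ ≤ (D * ∫⁻ w in Metric.ball z δ, gauss α f w ^ (s / a)) ^ a * (M * ν (square z r)) := by
          gcongr; exact hDb f hf z
      _ = M * (D ^ a * ((∫⁻ w in Metric.ball z δ, gauss α f w ^ (s / a)) ^ a *
            ν (square z r))) := by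
          rw [ENNReal.mul_rpow_of_nonneg _ _ ha.le]; ring
      _ ≤ M * (D ^ a * (C * ∫⁻ w in square z r, F w ^ a ∂ν)) := by gcongr
      _ ≤ M * (D ^ a * (C * ∫⁻ w in Metric.ball z 1, gauss α f w ^ s ∂ν)) := by gcongr
      _ = _ := by ring

/-! ### Sufficiency: from averages to Carleson embeddings -/

lemma measurable_measure_ball (ν : Measure ℂ) [SFinite ν] (ρ : ℝ) :
    Measurable fun u => ν (Metric.ball u ρ) := by
  have : MeasurableSet {x : ℂ × ℂ | dist x.2 x.1 < ρ} :=
    (isOpen_lt (by fun_prop) continuous_const).measurableSet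
  exact measurable_measure_prodMk_left this

/-- The averaging function of `μ` with respect to `ν`. -/
def ratio (μ ν : Measure ℂ) (u : ℂ) : ℝ≥0∞ := μ (Metric.ball u 1) / ν (Metric.ball u 1)

lemma measurable_ratio (μ ν : Measure ℂ) [SFinite μ] [SFinite ν] : Measurable (ratio μ ν) :=
  (measurable_measure_ball μ 1).div (measurable_measure_ball ν 1)

lemma Regular.exists_ball_le {ν : Measure ℂ} (h : Regular ν) (ρ : ℝ) :
    ∃ M : ℝ≥0∞, M ≠ ∞ ∧ ∀ z z', dist z z' ≤ ρ →
      ν (Metric.ball z 1) ≤ M * ν (Metric.ball z' 1) := by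
  obtain ⟨L, c, hc, hg⟩ := h.growth
  refine ⟨ENNReal.ofReal (Real.exp (L + c * ρ)), ENNReal.ofReal_ne_top, fun z z' hz => ?_⟩
  refine (hg z z').trans ?_
  gcongr

/-- The value at z is bounded by a ν-mean over D(z,1), the normalization ν(D(z,1)) is exchanged for
ν(D(u,1)), and Fubini applies because u ∈ D(z,1) iff z ∈ D(u,1). -/
lemma Regular.exists_lintegral_gauss_le {μ ν : Measure ℂ} [SFinite μ] [SFinite ν] (h : Regular ν)
    {α q : ℝ} (hα : 0 < α) (hq : 0 < q) :
    ∃ C : ℝ≥0∞, C ≠ ∞ ∧ ∀ f : ℂ → ℂ, Differentiable ℂ f →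
      ∫⁻ z, gauss α f z ^ q ∂μ ≤ C * ∫⁻ u, gauss α f u ^ q * ratio μ ν u ∂ν := by
  obtain ⟨C, hC, hsub⟩ := h.submean α q hα hq
  obtain ⟨M, hM, hV⟩ := h.exists_ball_le 1
  refine ⟨C * M, ENNReal.mul_ne_top hC hM, fun f hf => ?_⟩
  have hfm := (measurable_gauss α hf.continuous).pow_const q
  set H : ℂ → ℝ≥0∞ := fun u => gauss α f u ^ q * (ν (Metric.ball u 1))⁻¹ with hH
  have hHm : Measurable H := hfm.mul (measurable_measure_ball ν 1).inv
  have hpt : ∀ z, gauss α f z ^ q ≤ C * M * ∫⁻ u, (Metric.ball z 1).indicator H u ∂ν := by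
    intro z
    rw [lintegral_indicator Metric.isOpen_ball.measurableSet, mul_assoc,
      ← lintegral_const_mul' M _ hM]
    have h1 : gauss α f z ^ q = gauss α f z ^ q * ν (Metric.ball z 1) * (ν (Metric.ball z 1))⁻¹ := by
      rw [mul_assoc, ENNReal.mul_inv_cancel (h.ne_zero z) (h.ne_top z), mul_one]
    rw [h1]
    refine (mul_le_mul_left (hsub f hf z) _).trans ?_
    rw [mul_assoc, ← lintegral_mul_const' _ _ (ENNReal.inv_ne_top.2 (h.ne_zero z))]
    gcongr C * ?_
    refine setLIntegral_mono' Metric.isOpen_ball.measurableSet fun u hu => ?_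
    rw [hH, mul_left_comm]
    gcongr
    rw [← ENNReal.div_eq_inv_mul.trans (mul_comm _ _),
      ENNReal.le_div_iff_mul_le (Or.inl (h.ne_zero u)) (Or.inl (h.ne_top u)), mul_comm,
      ← div_eq_mul_inv]
    exact ENNReal.div_le_of_le_mul (hV u z (Metric.mem_ball.1 hu).le)
  have hm2 : Measurable fun x : ℂ × ℂ => (Metric.ball x.1 1).indicator H x.2 := by
    have hs : MeasurableSet {x : ℂ × ℂ | dist x.2 x.1 < 1} :=
      (isOpen_lt (by fun_prop) continuous_const).measurableSet
    exact (hHm.comp measurable_snd).indicator hs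
  calc ∫⁻ z, gauss α f z ^ q ∂μ
      ≤ ∫⁻ z, C * M * ∫⁻ u, (Metric.ball z 1).indicator H u ∂ν ∂μ := lintegral_mono hpt
    _ = C * M * ∫⁻ z, ∫⁻ u, (Metric.ball z 1).indicator H u ∂ν ∂μ :=
        lintegral_const_mul' _ _ (ENNReal.mul_ne_top hC hM)
    _ = C * M * ∫⁻ u, ∫⁻ z, (Metric.ball z 1).indicator H u ∂μ ∂ν := by
        rw [lintegral_lintegral_swap hm2.aemeasurable]
    _ = _ := by
        congr 1
        refine lintegral_congr fun u => ?_
        have : ∀ z, (Metric.ball z 1).indicator H u =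
            (Metric.ball u 1).indicator (fun _ => H u) z := fun z => by
          simp only [Set.indicator, Metric.mem_ball, dist_comm]
        simp_rw [this]
        rw [lintegral_indicator Metric.isOpen_ball.measurableSet, setLIntegral_const, hH, ratio,
          div_eq_mul_inv]
        ring

/-- Of the q powers of the modulus, p are integrated. The sub-mean value inequality bounds the other
q - p, and the resulting power of ν(D(u,1)) cancels the one allowed in the hypothesis. -/
lemma Regular.lintegral_gauss_lt_top_of_le {μ ν : Measure ℂ} [SFinite μ] [SFinite ν]
    (h : Regular ν) {α p q : ℝ} (hα : 0 < α) (hp : 0 < p) (hpq : p ≤ q) {C : ℝ≥0∞} (hC : C ≠ ∞)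
    (hG : ∀ u, ratio μ ν u ≤ C * ν (Metric.ball u 1) ^ ((q - p) / p))
    {f : ℂ → ℂ} (hf : Differentiable ℂ f) (hfp : ∫⁻ z, gauss α f z ^ p ∂ν < ∞) :
    ∫⁻ z, gauss α f z ^ q ∂μ < ∞ := by
  obtain ⟨K, hK, hle⟩ := h.exists_lintegral_gauss_le (μ := μ) hα (hp.trans_le hpq)
  obtain ⟨D, hD, hsub⟩ := h.submean α p hα hp
  set I := ∫⁻ z, gauss α f z ^ p ∂ν with hI
  have hexp : 0 ≤ (q - p) / p := div_nonneg (by linarith) hp.le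
  set A := C * (D * I) ^ ((q - p) / p) with hA
  have hAt : A ≠ ∞ := ENNReal.mul_ne_top hC
    (ENNReal.rpow_ne_top_of_nonneg hexp (ENNReal.mul_ne_top hD hfp.ne))
  have hpt : ∀ u, gauss α f u ^ q * ratio μ ν u ≤ A * gauss α f u ^ p := by
    intro u
    have h1 : gauss α f u ^ p * ν (Metric.ball u 1) ≤ D * I :=
      (hsub f hf u).trans (by gcongr; exact setLIntegral_le_lintegral _ _)
    have h2 : gauss α f u ^ q = gauss α f u ^ p * (gauss α f u ^ p) ^ ((q - p) / p) := by
      rw [← ENNReal.rpow_mul, mul_div_cancel₀ _ hp.ne',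
        ← ENNReal.rpow_add_of_nonneg _ _ hp.le (by linarith), add_sub_cancel]
    calc gauss α f u ^ q * ratio μ ν u
        ≤ gauss α f u ^ p * (gauss α f u ^ p) ^ ((q - p) / p) *
          (C * ν (Metric.ball u 1) ^ ((q - p) / p)) := by rw [h2]; gcongr; exact hG u
      _ = gauss α f u ^ p * (C * (gauss α f u ^ p * ν (Metric.ball u 1)) ^ ((q - p) / p)) := by
          rw [ENNReal.mul_rpow_of_nonneg _ _ hexp]; ring
      _ ≤ gauss α f u ^ p * (C * (D * I) ^ ((q - p) / p)) := by gcongr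
      _ = _ := by rw [mul_comm]
  calc ∫⁻ z, gauss α f z ^ q ∂μ ≤ K * ∫⁻ u, gauss α f u ^ q * ratio μ ν u ∂ν := hle f hf
    _ ≤ K * ∫⁻ u, A * gauss α f u ^ p ∂ν := mul_le_mul_right (lintegral_mono hpt) _
    _ = K * (A * I) := by rw [lintegral_const_mul' _ _ hAt]
    _ < ∞ := (ENNReal.mul_ne_top hK (ENNReal.mul_ne_top hAt hfp.ne)).lt_top

/-- Hölder with the conjugate exponents p/q and p/(p-q). -/
lemma Regular.lintegral_gauss_lt_top_of_lt {μ ν : Measure ℂ} [SFinite μ] [SFinite ν]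
    (h : Regular ν) {α p q : ℝ} (hα : 0 < α) (hq : 0 < q) (hqp : q < p)
    (hG : ∫⁻ u, ratio μ ν u ^ (p / (p - q)) ∂ν < ∞)
    {f : ℂ → ℂ} (hf : Differentiable ℂ f) (hfp : ∫⁻ z, gauss α f z ^ p ∂ν < ∞) :
    ∫⁻ z, gauss α f z ^ q ∂μ < ∞ := by
  obtain ⟨K, hK, hle⟩ := h.exists_lintegral_gauss_le (μ := μ) hα hq
  have hp : 0 < p := hq.trans hqp
  have hsub : 0 < p - q := sub_pos.2 hqp
  have hconj : (p / q).HolderConjugate (p / (p - q)) := by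
    rw [Real.holderConjugate_iff]
    refine ⟨(one_lt_div hq).2 hqp, ?_⟩
    field_simp
    ring
  refine (hle f hf).trans_lt (ENNReal.mul_ne_top hK ?_).lt_top
  have hh := ENNReal.lintegral_mul_le_Lp_mul_Lq ν hconj
    (f := fun u => gauss α f u ^ q) (g := ratio μ ν)
    ((measurable_gauss α hf.continuous).pow_const q).aemeasurable
    (measurable_ratio μ ν).aemeasurable
  refine ne_top_of_le_ne_top (ENNReal.mul_ne_top ?_ ?_) hh
  · refine ENNReal.rpow_ne_top_of_nonneg (by positivity) ?_
    simp_rw [← ENNReal.rpow_mul, mul_div_cancel₀ p hq.ne']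
    exact hfp.ne
  · exact ENNReal.rpow_ne_top_of_nonneg (by positivity) hG.ne

/-! ### Sums over the lattice -/

/-- The Gaussian integers as points of the plane. -/
def lat (n : ℤ × ℤ) : ℂ := ⟨n.1, n.2⟩

@[simp] lemma lat_zero : lat 0 = 0 := by apply Complex.ext <;> simp [lat]

lemma lat_sub (n k : ℤ × ℤ) : lat (n - k) = lat n - lat k := by
  apply Complex.ext <;> simp [lat]

lemma exists_dist_lat_lt (z : ℂ) : ∃ n, dist z (lat n) < 1 := by
  refine ⟨(round z.re, round z.im), ?_⟩
  rw [dist_eq_norm, ← sq_lt_one_iff₀ (norm_nonneg _), ← Complex.normSq_eq_norm_sq,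
    Complex.normSq_apply]
  have h1 := abs_sub_round z.re
  have h2 := abs_sub_round z.im
  have h3 := sq_le_sq' (abs_le.1 h1).1 (abs_le.1 h1).2
  have h4 := sq_le_sq' (abs_le.1 h2).1 (abs_le.1 h2).2
  simp only [lat, Complex.sub_re, Complex.sub_im]
  nlinarith

lemma summable_exp_neg_norm_lat : Summable fun n => Real.exp (-‖lat n‖) := by
  have h1 : Summable fun k : ℤ => Real.exp (-(|(k : ℝ)| / 2)) := by
    have : Summable fun k : ℕ => Real.exp (-((k : ℝ) / 2)) := by
      have := Real.summable_exp_nat_mul_iff.2 (show (-(1 / 2) : ℝ) < 0 by norm_num)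
      refine this.congr fun k => ?_
      congr 1; ring
    refine Summable.of_nat_of_neg ?_ ?_ <;> simpa using this
  refine Summable.of_nonneg_of_le (fun n => (Real.exp_pos _).le) (fun n => ?_)
    (h1.mul_of_nonneg h1 (fun k => (Real.exp_pos _).le) fun k => (Real.exp_pos _).le)
  rw [← Real.exp_add, Real.exp_le_exp]
  have h2 := Complex.abs_re_le_norm (lat n)
  have h3 := Complex.abs_im_le_norm (lat n)
  simp only [lat] at h2 h3 ⊢
  linarith

lemma summable_exp_sub_sq_norm_lat (L A : ℝ) {B : ℝ} (hB : 0 < B) :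
    Summable fun n => Real.exp (L + A * ‖lat n‖ - B * ‖lat n‖ ^ 2) := by
  refine Summable.of_nonneg_of_le (fun n => (Real.exp_pos _).le) (fun n => ?_)
    (summable_exp_neg_norm_lat.mul_left (Real.exp (L + (A + 1) ^ 2 / (4 * B))))
  rw [← Real.exp_add, Real.exp_le_exp]
  have : (A + 1) ^ 2 / (4 * B) - ((A + 1) * ‖lat n‖ - B * ‖lat n‖ ^ 2) =
      (A + 1 - 2 * B * ‖lat n‖) ^ 2 / (4 * B) := by field_simp; ring
  have : 0 ≤ (A + 1 - 2 * B * ‖lat n‖) ^ 2 / (4 * B) := by positivity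
  linarith

lemma exists_tail_le {E : ℤ × ℤ → ℝ≥0∞} (hE : ∑' n, E n ≠ ∞) {ε : ℝ≥0∞} (hε : 0 < ε) :
    ∃ N : ℕ, ∑' n, {n | (N : ℝ) ≤ ‖lat n‖}.indicator E n ≤ ε := by
  obtain ⟨s, hs⟩ := ((ENNReal.tendsto_tsum_compl_atTop_zero hE).eventually_lt_const hε).exists
  obtain ⟨N, hN⟩ := exists_nat_gt (∑ n ∈ s, ‖lat n‖)
  refine ⟨N, le_trans ?_ hs.le⟩
  have : ∑' n : {n // n ∉ s}, E n = ∑' n, {n | n ∉ s}.indicator E n :=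
    tsum_subtype {n | n ∉ s} E
  rw [this]
  refine ENNReal.tsum_le_tsum fun n => Set.indicator_le_indicator_of_subset ?_ (fun _ => zero_le) n
  intro n hn hns
  have h1 : ‖lat n‖ ≤ ∑ n ∈ s, ‖lat n‖ :=
    Finset.single_le_sum (f := fun n => ‖lat n‖) (fun _ _ => norm_nonneg _) hns
  have h2 : (N : ℝ) ≤ ‖lat n‖ := hn
  linarith

/-! ### Entire functions with prescribed Gaussian modulus -/

/-- The normalized reproducing kernel at `w`. -/
def kern (α : ℝ) (w z : ℂ) : ℂ :=
  Complex.exp (α * (starRingEnd ℂ w) * z - (α / 2 * ‖w‖ ^ 2 : ℝ))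

lemma differentiable_kern (α : ℝ) (w : ℂ) : Differentiable ℂ (kern α w) := by
  unfold kern
  fun_prop

lemma norm_kern_le {α R : ℝ} (hα : 0 < α) (w z : ℂ) (hz : ‖z‖ ≤ R) :
    ‖kern α w z‖ ≤ Real.exp (α * R * ‖w‖ - α / 2 * ‖w‖ ^ 2) := by
  rw [kern, Complex.norm_exp, Real.exp_le_exp, Complex.sub_re, Complex.ofReal_re]
  gcongr
  refine (Complex.re_le_norm _).trans ?_
  rw [norm_mul, norm_mul, Complex.norm_real, RCLike.norm_conj, Real.norm_of_nonneg hα.le]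
  nlinarith [mul_le_mul_of_nonneg_left hz (mul_nonneg hα.le (norm_nonneg w))]

lemma gauss_kern (α : ℝ) (w z : ℂ) :
    gauss α (kern α w) z = ENNReal.ofReal (Real.exp (-(α / 2) * dist z w ^ 2)) := by
  rw [gauss, ← ofReal_norm, ← ENNReal.ofReal_mul (norm_nonneg _), kern, Complex.norm_exp,
    ← Real.exp_add]
  congr 2
  rw [dist_eq_norm, ← Complex.normSq_eq_norm_sq, ← Complex.normSq_eq_norm_sq,
    ← Complex.normSq_eq_norm_sq, Complex.normSq_sub]
  simp [Complex.normSq_apply]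
  ring

/-- Prescribing the Gaussian modulus of an entire function up to constants: from above everywhere,
and from below near a sufficiently sparse set of lattice points. -/
lemma exists_entire_gauss_comparable {α : ℝ} (hα : 0 < α) (L c : ℝ) :
    ∃ N : ℕ, ∃ C : ℝ≥0∞, C ≠ ∞ ∧ ∀ b : ℤ × ℤ → ℝ≥0∞, (∀ n, b n ≠ ∞) →
      (∀ k n, b k ≤ ENNReal.ofReal (Real.exp (L + c * ‖lat (k - n)‖)) * b n) →
      ∀ S : Set (ℤ × ℤ), (∀ n ∈ S, ∀ k ∈ S, k ≠ n → (N : ℝ) ≤ ‖lat (k - n)‖) →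
      ∃ f : ℂ → ℂ, Differentiable ℂ f ∧
        (∀ n z, dist z (lat n) ≤ 3 → gauss α f z ≤ C * b n) ∧
        ∀ n ∈ S, ∀ z, dist z (lat n) ≤ 3 → b n ≤ C * gauss α f z := by
  -- Bound for the kernel centered j away, relative to b n, at points within 3 of lattice point n:
  -- ‖j‖² ≤ 2 dist² + 2·9 halves the Gaussian rate and costs the constant (α/2)·9.
  set E : ℤ × ℤ → ℝ≥0∞ := fun j =>
    ENNReal.ofReal (Real.exp (L + α / 2 * 9 + c * ‖lat j‖ - α / 4 * ‖lat j‖ ^ 2)) with hE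
  have hEs : ∑' j, E j ≠ ∞ :=
    (summable_exp_sub_sq_norm_lat _ _ (by positivity)).tsum_ofReal_ne_top
  -- Half the least value of a kernel's Gaussian modulus within distance 3 of its center. With N
  -- chosen so that the other kernels contribute at most ε, half of the main term survives.
  set ε : ℝ≥0∞ := ENNReal.ofReal (Real.exp (-(α / 2) * 9) / 2) with hε
  have hε0 : 0 < ε := ENNReal.ofReal_pos.2 (by positivity)
  have hεt : ε ≠ ∞ := ENNReal.ofReal_ne_top
  obtain ⟨N, hN⟩ := exists_tail_le hEs hε0
  refine ⟨N, ∑' j, E j + ε⁻¹, ENNReal.add_ne_top.2 ⟨hEs, ENNReal.inv_ne_top.2 hε0.ne'⟩,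
    fun b hb hbL S hS => ?_⟩
  classical
  set β : ℤ × ℤ → ℂ := fun n => if n ∈ S then ((b n).toReal : ℂ) else 0 with hβ
  have hβS : ∀ n ∈ S, ‖β n‖ₑ = b n := fun n hn => by
    rw [hβ]
    simp only [hn, if_true]
    rw [← ofReal_norm, Complex.norm_real, Real.norm_of_nonneg ENNReal.toReal_nonneg,
      ENNReal.ofReal_toReal (hb n)]
  have hβ0 : ∀ n, n ∉ S → β n = 0 := fun n hn => by simp [hβ, hn]
  have hβle : ∀ n, ‖β n‖ₑ ≤ b n := fun n => by
    by_cases hn : n ∈ S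
    · exact (hβS n hn).le
    · simp [hβ0 n hn]
  set f : ℂ → ℂ := fun z => ∑' n, β n * kern α (lat n) z with hf
  -- Coefficients grow at most exponentially from b 0, while the kernels carry exp(-α|w|²/2); the
  -- series converges locally uniformly, so its sum is entire.
  have hbound : ∀ R : ℝ, ∃ u : ℤ × ℤ → ℝ, Summable u ∧
      ∀ n z, ‖z‖ ≤ R → ‖β n * kern α (lat n) z‖ ≤ u n := by
    intro R
    refine ⟨fun n => (b 0).toReal * Real.exp (L + (c + α * R) * ‖lat n‖ - α / 2 * ‖lat n‖ ^ 2),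
      (summable_exp_sub_sq_norm_lat _ _ (by positivity)).mul_left _, fun n z hz => ?_⟩
    have h1 : ‖β n‖ ≤ Real.exp (L + c * ‖lat n‖) * (b 0).toReal := by
      have h2 := (hβle n).trans (hbL n 0)
      rw [sub_zero] at h2
      have h3 := ENNReal.toReal_mono (ENNReal.mul_ne_top ENNReal.ofReal_ne_top (hb 0)) h2
      rwa [toReal_enorm, ENNReal.toReal_mul, ENNReal.toReal_ofReal (Real.exp_pos _).le] at h3
    calc ‖β n * kern α (lat n) z‖
        ≤ (Real.exp (L + c * ‖lat n‖) * (b 0).toReal) *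
          Real.exp (α * R * ‖lat n‖ - α / 2 * ‖lat n‖ ^ 2) := by
          rw [norm_mul]
          exact mul_le_mul h1 (norm_kern_le hα _ _ hz) (norm_nonneg _) (by positivity)
      _ = (b 0).toReal * (Real.exp (L + c * ‖lat n‖) *
          Real.exp (α * R * ‖lat n‖ - α / 2 * ‖lat n‖ ^ 2)) := by ring
      _ = _ := by
          rw [← Real.exp_add]
          congr 2; ring
  have hsum : ∀ z, Summable fun n => β n * kern α (lat n) z := fun z => by
    obtain ⟨u, hu, hle⟩ := hbound ‖z‖
    exact Summable.of_norm_bounded hu fun n => hle n z le_rfl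
  have hfd : Differentiable ℂ f := fun z => by
    obtain ⟨u, hu, hle⟩ := hbound (‖z‖ + 1)
    have hd : DifferentiableOn ℂ f (Metric.ball 0 (‖z‖ + 1)) :=
      Complex.differentiableOn_tsum_of_summable_norm hu
        (fun n => ((differentiable_kern α (lat n)).const_mul _).differentiableOn)
        Metric.isOpen_ball fun n w hw => hle n w (mem_ball_zero_iff.1 hw).le
    exact hd.differentiableAt (Metric.isOpen_ball.mem_nhds (by simp))
  have hterm : ∀ n z, dist z (lat n) ≤ 3 → ∀ k,
      gauss α (fun w => β k * kern α (lat k) w) z ≤ b n * E (k - n) := by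
    intro n z hz k
    have h1 : gauss α (fun w => β k * kern α (lat k) w) z = ‖β k‖ₑ * gauss α (kern α (lat k)) z := by
      simp only [gauss, enorm_mul, mul_assoc]
    rw [h1, gauss_kern]
    refine (mul_le_mul_left ((hβle k).trans (hbL k n)) _).trans ?_
    rw [mul_right_comm, mul_comm (b n), hE, ← ENNReal.ofReal_mul (Real.exp_pos _).le,
      ← Real.exp_add]
    refine mul_le_mul_left (ENNReal.ofReal_le_ofReal (Real.exp_le_exp.2 ?_)) _
    have h2 : ‖lat (k - n)‖ ≤ dist z (lat k) + dist z (lat n) := by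
      rw [lat_sub, ← dist_eq_norm, dist_comm z (lat k)]
      exact dist_triangle _ _ _
    have h3 : ‖lat (k - n)‖ ^ 2 ≤ 2 * dist z (lat k) ^ 2 + 2 * 9 := by
      have := norm_nonneg (lat (k - n))
      have h4 : dist z (lat n) ^ 2 ≤ 9 := by nlinarith [dist_nonneg (x := z) (y := lat n)]
      nlinarith [sq_nonneg (dist z (lat k) - dist z (lat n))]
    nlinarith [mul_le_mul_of_nonneg_left h3 (show 0 ≤ α / 4 by positivity)]
  have hshift : ∀ (F : ℤ × ℤ → ℝ≥0∞) n, ∑' k, F (k - n) = ∑' k, F k := fun F n =>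
    (Equiv.subRight n).tsum_eq F
  have henorm : ∀ g : ℤ × ℤ → ℂ, ‖∑' n, g n‖ₑ ≤ ∑' n, ‖g n‖ₑ := fun g =>
    enorm_tsum_le_tsum_enorm
  refine ⟨f, hfd, fun n z hz => ?_, fun n hn z hz => ?_⟩
  · calc gauss α f z ≤ (∑' k, ‖β k * kern α (lat k) z‖ₑ) *
          ENNReal.ofReal (Real.exp (-(α / 2) * ‖z‖ ^ 2)) := by
          rw [gauss]; gcongr; exact henorm _
      _ = ∑' k, gauss α (fun w => β k * kern α (lat k) w) z := by
          rw [← ENNReal.tsum_mul_right]; rfl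
      _ ≤ ∑' k, b n * E (k - n) := ENNReal.tsum_le_tsum (hterm n z hz)
      _ = (∑' k, E k) * b n := by rw [ENNReal.tsum_mul_left, hshift, mul_comm]
      _ ≤ _ := by gcongr; exact le_self_add
  · set rest : ℂ := ∑' k, if k = n then 0 else β k * kern α (lat k) z with hrest
    have hsplit : f z = β n * kern α (lat n) z + rest := (hsum z).tsum_eq_add_tsum_ite n
    set e := ENNReal.ofReal (Real.exp (-(α / 2) * ‖z‖ ^ 2)) with he
    have hr : ‖rest‖ₑ * e ≤ b n * ε := by
      calc ‖rest‖ₑ * e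
          ≤ (∑' k, ‖if k = n then 0 else β k * kern α (lat k) z‖ₑ) * e := by
            gcongr; exact henorm _
        _ = ∑' k, ‖if k = n then 0 else β k * kern α (lat k) z‖ₑ * e :=
            ENNReal.tsum_mul_right.symm
        _ ≤ ∑' k, b n * {j | (N : ℝ) ≤ ‖lat j‖}.indicator E (k - n) := by
            refine ENNReal.tsum_le_tsum fun k => ?_
            by_cases hkn : k = n
            · simp [hkn]
            by_cases hkS : k ∈ S
            · have hmem : k - n ∈ {j | (N : ℝ) ≤ ‖lat j‖} := hS n hn k hkS hkn
              rw [if_neg hkn, Set.indicator_of_mem hmem]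
              exact hterm n z hz k
            · simp [hβ0 k hkS]
        _ ≤ b n * ε := by
            rw [ENNReal.tsum_mul_left, hshift]
            gcongr
    have hmain : b n * (ε + ε) ≤ gauss α f z + b n * ε := by
      have h1 : b n * (ε + ε) ≤ ‖β n * kern α (lat n) z‖ₑ * e := by
        rw [enorm_mul, mul_assoc, hβS n hn]
        have : ‖kern α (lat n) z‖ₑ * e = gauss α (kern α (lat n)) z := rfl
        rw [this, gauss_kern, hε, ← ENNReal.ofReal_add (by positivity) (by positivity), add_halves]
        gcongr b n * ENNReal.ofReal (Real.exp ?_)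
        have h4 : dist z (lat n) ^ 2 ≤ 9 := by nlinarith [dist_nonneg (x := z) (y := lat n)]
        nlinarith
      have h2 : ‖β n * kern α (lat n) z‖ₑ ≤ ‖f z‖ₑ + ‖rest‖ₑ := by
        rw [show β n * kern α (lat n) z = f z - rest by rw [hsplit]; ring]
        exact enorm_sub_le
      calc b n * (ε + ε) ≤ (‖f z‖ₑ + ‖rest‖ₑ) * e := h1.trans (by gcongr)
        _ ≤ _ := by rw [add_mul]; exact add_le_add le_rfl hr
    rw [mul_add] at hmain
    have h3 : b n * ε ≤ gauss α f z :=
      ENNReal.le_of_add_le_add_right (ENNReal.mul_ne_top (hb n) hεt) hmain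
    calc b n = ε⁻¹ * (b n * ε) := by
          rw [mul_left_comm, ENNReal.inv_mul_cancel hε0.ne' hεt, mul_one]
      _ ≤ ε⁻¹ * gauss α f z := by gcongr
      _ ≤ _ := by gcongr; exact le_add_self

/-! ### Necessity: testing the embedding on sparse kernel sums -/

/-- Lattice points with the same residues modulo `N`. -/
def residue (N : ℕ) (n : ℤ × ℤ) : ZMod N × ZMod N := (n.1, n.2)

lemma le_norm_lat_of_residue_eq {N : ℕ} {n k : ℤ × ℤ} (h : residue N k = residue N n)
    (hne : k ≠ n) : (N : ℝ) ≤ ‖lat (k - n)‖ := by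
  have key : ∀ a b : ℤ, (a : ZMod N) = b → a ≠ b → (N : ℝ) ≤ |((a - b : ℤ) : ℝ)| := by
    intro a b hab hne
    have hdvd : (N : ℤ) ∣ a - b := (ZMod.intCast_eq_intCast_iff_dvd_sub b a N).1 hab.symm
    have := Int.le_of_dvd (abs_pos.2 (sub_ne_zero.2 hne)) ((dvd_abs _ _).2 hdvd)
    rw [← Int.cast_abs]
    exact_mod_cast this
  simp only [residue, Prod.mk.injEq] at h
  by_cases h1 : k.1 = n.1
  · exact (key _ _ h.2 fun h2 => hne (Prod.ext h1 h2)).trans (Complex.abs_im_le_norm (lat (k - n)))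
  · exact (key _ _ h.1 h1).trans (Complex.abs_re_le_norm (lat (k - n)))

/-- A measure for which the Carleson embedding holds has weighted summable masses near the lattice
points, for every summable weight. -/
lemma Regular.tsum_rpow_mul_ne_top {μ ν : Measure ℂ} (h : Regular ν) {α p q : ℝ} (hα : 0 < α)
    (hp : 0 < p) (hq : 0 < q)
    (hcar : ∀ f : ℂ → ℂ, Differentiable ℂ f → ∫⁻ z, gauss α f z ^ p ∂ν < ∞ →
      ∫⁻ z, gauss α f z ^ q ∂μ < ∞)
    {a : ℤ × ℤ → ℝ≥0∞} (ha : ∑' n, a n ≠ ∞) :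
    ∑' n, a n ^ (q / p) *
      (μ (Metric.ball (lat n) 3) / ν (Metric.ball (lat n) 1) ^ (q / p)) ≠ ∞ := by
  obtain ⟨L, c, hc, hg⟩ := h.growth
  set V : ℤ × ℤ → ℝ≥0∞ := fun n => ν (Metric.ball (lat n) 1) with hV
  have hV0 : ∀ n, V n ≠ 0 := fun n => h.ne_zero _
  have hVt : ∀ n, V n ≠ ∞ := fun n => h.ne_top _
  set e : ℤ × ℤ → ℝ≥0∞ := fun j => ENNReal.ofReal (Real.exp (-‖lat j‖)) with he
  have hes : ∑' j, e j ≠ ∞ := summable_exp_neg_norm_lat.tsum_ofReal_ne_top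
  -- Convolution with exp(-‖j‖) gives a summable majorant of a that varies at most exponentially, as
  -- the construction of test functions requires.
  set A : ℤ × ℤ → ℝ≥0∞ := fun n => ∑' k, a k * e (n - k) with hA
  have hAs : ∑' n, A n ≠ ∞ := by
    rw [hA, ENNReal.tsum_comm]
    simp_rw [ENNReal.tsum_mul_left]
    have : ∀ k, ∑' n, e (n - k) = ∑' n, e n := fun k => (Equiv.subRight k).tsum_eq e
    simp_rw [this, ENNReal.tsum_mul_right]
    exact ENNReal.mul_ne_top ha hes
  have hAt : ∀ n, A n ≠ ∞ := ENNReal.ne_top_of_tsum_ne_top hAs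
  have haA : ∀ n, a n ≤ A n := fun n => by
    refine le_trans (by simp [he]) (ENNReal.le_tsum (f := fun k => a k * e (n - k)) n)
  have hAA : ∀ k n, A k ≤ ENNReal.ofReal (Real.exp ‖lat (k - n)‖) * A n := by
    intro k n
    rw [hA, ← ENNReal.tsum_mul_left]
    refine ENNReal.tsum_le_tsum fun j => ?_
    rw [mul_left_comm]
    gcongr
    rw [he, ← ENNReal.ofReal_mul (Real.exp_pos _).le, ← Real.exp_add]
    refine ENNReal.ofReal_le_ofReal (Real.exp_le_exp.2 ?_)
    have h3 := norm_sub_le (lat (k - j)) (lat (k - n))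
    rw [show lat (k - j) - lat (k - n) = lat (n - j) by simp only [lat_sub]; ring] at h3
    linarith
  set b : ℤ × ℤ → ℝ≥0∞ := fun n => (A n / V n) ^ (1 / p) with hb
  have hp1 : 0 ≤ 1 / p := by positivity
  have hbt : ∀ n, b n ≠ ∞ := fun n =>
    ENNReal.rpow_ne_top_of_nonneg hp1 (ENNReal.div_ne_top (hAt n) (hV0 n))
  have hbp : ∀ n, b n ^ p * V n = A n := fun n => by
    rw [hb, ← ENNReal.rpow_mul, one_div_mul_cancel hp.ne', ENNReal.rpow_one,
      ENNReal.div_mul_cancel (hV0 n) (hVt n)]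
  have hbq : ∀ n, a n ^ (q / p) / V n ^ (q / p) ≤ b n ^ q := fun n => by
    rw [hb, ← ENNReal.rpow_mul, one_div_mul_eq_div,
      ← ENNReal.div_rpow_of_nonneg _ _ (by positivity)]
    gcongr
    exact haA n
  have hbL : ∀ k n, b k ≤
      ENNReal.ofReal (Real.exp (L / p + (c + 1) / p * ‖lat (k - n)‖)) * b n := by
    intro k n
    have h1 : A k / V k ≤
        ENNReal.ofReal (Real.exp (L + (c + 1) * ‖lat (k - n)‖)) * (A n / V n) := by
      refine ENNReal.div_le_of_le_mul ?_
      have h2 : V n ≤ ENNReal.ofReal (Real.exp (L + c * ‖lat (k - n)‖)) * V k := by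
        have := hg (lat n) (lat k)
        rwa [dist_comm, dist_eq_norm, ← lat_sub] at this
      calc A k ≤ ENNReal.ofReal (Real.exp ‖lat (k - n)‖) * (A n / V n * V n) := by
            rw [ENNReal.div_mul_cancel (hV0 n) (hVt n)]; exact hAA k n
        _ ≤ ENNReal.ofReal (Real.exp ‖lat (k - n)‖) * (A n / V n *
              (ENNReal.ofReal (Real.exp (L + c * ‖lat (k - n)‖)) * V k)) := by gcongr
        _ = (ENNReal.ofReal (Real.exp ‖lat (k - n)‖) *
              ENNReal.ofReal (Real.exp (L + c * ‖lat (k - n)‖))) * (A n / V n) * V k := by ring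
        _ = _ := by
            rw [← ENNReal.ofReal_mul (Real.exp_pos _).le, ← Real.exp_add]
            congr 4; ring
    calc b k ≤ (ENNReal.ofReal (Real.exp (L + (c + 1) * ‖lat (k - n)‖)) * (A n / V n)) ^ (1 / p) :=
          ENNReal.rpow_le_rpow h1 hp1
      _ = _ := by
          rw [ENNReal.mul_rpow_of_nonneg _ _ hp1, ENNReal.ofReal_rpow_of_pos (Real.exp_pos _),
            ← Real.exp_mul]
          congr 3; ring
  obtain ⟨N₀, C, hC, hex⟩ := exists_entire_gauss_comparable hα (L / p) ((c + 1) / p)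
  -- The extra 6 makes the discs of radius 3 around one residue class disjoint, and N nonzero, so
  -- that there are finitely many classes.
  set N := N₀ + 6 with hN
  have : NeZero N := ⟨by omega⟩
  have hNN : (N : ℝ) = N₀ + 6 := by rw [hN]; push_cast; rfl
  have hres : ∀ j, ∑' n : {n // residue N n = j}, a n ^ (q / p) *
      (μ (Metric.ball (lat n) 3) / V n ^ (q / p)) ≠ ∞ := by
    intro j
    obtain ⟨f, hf, hup, hlow⟩ := hex b hbt hbL {n | residue N n = j} fun n hn k hk hkn =>
      le_trans (by rw [hNN]; linarith)
        (le_norm_lat_of_residue_eq (hk.trans hn.symm : residue N k = residue N n) hkn)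
    have hfp : ∫⁻ z, gauss α f z ^ p ∂ν < ∞ := by
      have hcov : (⋃ n, Metric.ball (lat n) 1) = Set.univ :=
        Set.eq_univ_of_forall fun z => Set.mem_iUnion.2 (exists_dist_lat_lt z)
      rw [← setLIntegral_univ, ← hcov]
      calc ∫⁻ z in ⋃ n, Metric.ball (lat n) 1, gauss α f z ^ p ∂ν
          ≤ ∑' n, ∫⁻ z in Metric.ball (lat n) 1, gauss α f z ^ p ∂ν := lintegral_iUnion_le _ _
        _ ≤ ∑' n, ∫⁻ _ in Metric.ball (lat n) 1, (C * b n) ^ p ∂ν := by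
            refine ENNReal.tsum_le_tsum fun n =>
              setLIntegral_mono' Metric.isOpen_ball.measurableSet fun z hz => ?_
            gcongr
            exact hup n z (by linarith [Metric.mem_ball.1 hz])
        _ = ∑' n, C ^ p * A n := by
            refine tsum_congr fun n => ?_
            rw [setLIntegral_const, ENNReal.mul_rpow_of_nonneg _ _ hp.le, mul_assoc, hbp]
        _ < ∞ := by
            rw [ENNReal.tsum_mul_left]
            exact (ENNReal.mul_ne_top (ENNReal.rpow_ne_top_of_nonneg hp.le hC) hAs).lt_top
    have hfq := hcar f hf hfp
    refine ne_top_of_le_ne_top (ENNReal.mul_ne_top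
      (ENNReal.rpow_ne_top_of_nonneg hq.le hC) hfq.ne) ?_
    have hdisj : Pairwise (Function.onFun Disjoint
        fun n : {n // residue N n = j} => Metric.ball (lat n) 3) := by
      intro n k hnk
      refine Metric.ball_disjoint_ball ?_
      have h1 := le_norm_lat_of_residue_eq (n.2.trans k.2.symm) (fun h => hnk (Subtype.ext h))
      rw [lat_sub, ← dist_eq_norm, hNN] at h1
      have : (0 : ℝ) ≤ N₀ := by positivity
      linarith
    calc ∑' n : {n // residue N n = j}, a n ^ (q / p) * (μ (Metric.ball (lat n) 3) / V n ^ (q / p))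
        ≤ ∑' n : {n // residue N n = j},
            C ^ q * ∫⁻ z in Metric.ball (lat n) 3, gauss α f z ^ q ∂μ := by
          refine ENNReal.tsum_le_tsum fun n => ?_
          calc a n ^ (q / p) * (μ (Metric.ball (lat n) 3) / V n ^ (q / p))
              = (a n ^ (q / p) / V n ^ (q / p)) * μ (Metric.ball (lat n) 3) := by
                rw [ENNReal.div_eq_inv_mul, ENNReal.div_eq_inv_mul]; ring
            _ ≤ b n ^ q * μ (Metric.ball (lat n) 3) := by gcongr; exact hbq n
            _ = ∫⁻ _ in Metric.ball (lat n) 3, b n ^ q ∂μ := by rw [setLIntegral_const]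
            _ ≤ ∫⁻ z in Metric.ball (lat n) 3, C ^ q * gauss α f z ^ q ∂μ := by
                refine setLIntegral_mono' Metric.isOpen_ball.measurableSet fun z hz => ?_
                rw [← ENNReal.mul_rpow_of_nonneg _ _ hq.le]
                gcongr
                exact hlow n n.2 z (Metric.mem_ball.1 hz).le
            _ = _ := lintegral_const_mul' _ _ (ENNReal.rpow_ne_top_of_nonneg hq.le hC)
      _ = C ^ q * ∫⁻ z in ⋃ n : {n // residue N n = j}, Metric.ball (lat n) 3,
            gauss α f z ^ q ∂μ := by
          rw [ENNReal.tsum_mul_left, lintegral_iUnion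
            (fun _ => Metric.isOpen_ball.measurableSet) hdisj]
      _ ≤ _ := by gcongr; exact Measure.restrict_le_self
  rw [← (Equiv.sigmaFiberEquiv (residue N)).tsum_eq, ENNReal.tsum_sigma', tsum_fintype]
  exact ENNReal.sum_ne_top.2 fun j _ => hres j

/-! ### Uniform boundedness and duality for sequences -/

/-- If `∑ aₙ ^ t xₙ` is finite for all summable `a`, it is bounded on the unit ball of `ℓ¹`. -/
lemma exists_tsum_rpow_mul_le {ι : Type*} {x : ι → ℝ≥0∞} {t : ℝ} (ht : 0 < t)
    (h : ∀ a : ι → ℝ≥0∞, ∑' n, a n ≠ ∞ → ∑' n, a n ^ t * x n ≠ ∞) :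
    ∃ K : ℝ≥0∞, K ≠ ∞ ∧ ∀ a : ι → ℝ≥0∞, ∑' n, a n ≤ 1 → ∑' n, a n ^ t * x n ≤ K := by
  by_contra! hcon
  -- The threshold k·2^(kt) is such that a_k, scaled by 2^(-k), still contributes at least k; the
  -- sum of the scaled sequences is summable and contradicts finiteness.
  have hchoose : ∀ k : ℕ, ∃ a : ι → ℝ≥0∞, ∑' n, a n ≤ 1 ∧
      (k : ℝ≥0∞) * ((2 : ℝ≥0∞) ^ k) ^ t < ∑' n, a n ^ t * x n := fun k =>
    hcon _ (ENNReal.mul_ne_top (ENNReal.natCast_ne_top k)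
      (ENNReal.rpow_ne_top_of_nonneg ht.le (by finiteness)))
  choose a ha hax using hchoose
  set A : ι → ℝ≥0∞ := fun n => ∑' k, (2⁻¹ : ℝ≥0∞) ^ k * a k n with hA
  have hAs : ∑' n, A n ≠ ∞ := by
    rw [hA, ENNReal.tsum_comm]
    simp_rw [ENNReal.tsum_mul_left]
    refine ne_top_of_le_ne_top (b := ∑' k : ℕ, (2⁻¹ : ℝ≥0∞) ^ k) ?_
      (ENNReal.tsum_le_tsum fun k => mul_le_of_le_one_right' (ha k))
    rw [ENNReal.tsum_geometric, ENNReal.one_sub_inv_two, inv_inv]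
    exact ENNReal.ofNat_ne_top
  refine h A hAs (ENNReal.eq_top_of_forall_nnreal_le fun r => ?_)
  obtain ⟨k, hk⟩ := exists_nat_ge r
  have h2 : (2⁻¹ : ℝ≥0∞) ^ k * 2 ^ k = 1 := by
    rw [← mul_pow, ENNReal.inv_mul_cancel two_ne_zero ENNReal.ofNat_ne_top, one_pow]
  calc (r : ℝ≥0∞) ≤ (k : ℝ≥0∞) := by exact_mod_cast hk
    _ = ((2⁻¹ : ℝ≥0∞) ^ k) ^ t * (k * ((2 : ℝ≥0∞) ^ k) ^ t) := by
        rw [mul_left_comm, ← ENNReal.mul_rpow_of_nonneg _ _ ht.le, h2, ENNReal.one_rpow, mul_one]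
    _ ≤ ((2⁻¹ : ℝ≥0∞) ^ k) ^ t * ∑' n, a k n ^ t * x n := by gcongr; exact (hax k).le
    _ = ∑' n, ((2⁻¹ : ℝ≥0∞) ^ k * a k n) ^ t * x n := by
        rw [← ENNReal.tsum_mul_left]
        refine tsum_congr fun n => ?_
        rw [ENNReal.mul_rpow_of_nonneg _ _ ht.le, mul_assoc]
    _ ≤ ∑' n, A n ^ t * x n := by
        refine ENNReal.tsum_le_tsum fun n => ?_
        gcongr
        exact ENNReal.le_tsum (f := fun k => (2⁻¹ : ℝ≥0∞) ^ k * a k n) k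

lemma le_of_tsum_rpow_mul_le {ι : Type*} {x : ι → ℝ≥0∞} {t : ℝ} {K : ℝ≥0∞}
    (h : ∀ a : ι → ℝ≥0∞, ∑' n, a n ≤ 1 → ∑' n, a n ^ t * x n ≤ K) (n : ι) : x n ≤ K := by
  classical
  refine le_trans ?_ (h (Pi.single n 1) (by simp))
  refine le_trans (by simp) (ENNReal.le_tsum n)

/-- Duality of `ℓ^{1/t}` and `ℓ^{1/(1-t)}`. -/
lemma tsum_rpow_le_of_tsum_rpow_mul_le {ι : Type*} {x : ι → ℝ≥0∞} {t : ℝ} (ht : 0 < t)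
    (ht1 : t < 1) {K : ℝ≥0∞} (hK : K ≠ ∞)
    (h : ∀ a : ι → ℝ≥0∞, ∑' n, a n ≤ 1 → ∑' n, a n ^ t * x n ≤ K) :
    ∑' n, x n ^ (1 / (1 - t)) ≤ K ^ (1 / (1 - t)) := by
  classical
  have h1t : 0 < 1 - t := sub_pos.2 ht1
  set s := 1 / (1 - t) with hs
  have hs0 : 0 < s := by positivity
  have hxt : ∀ n, x n ≠ ∞ := fun n => ne_top_of_le_ne_top hK (le_of_tsum_rpow_mul_le h n)
  rw [ENNReal.tsum_eq_iSup_sum]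
  refine iSup_le fun F => ?_
  set T := ∑ n ∈ F, x n ^ s with hT
  by_cases hT0 : T = 0
  · simp [hT0]
  have hTt : T ≠ ∞ := ENNReal.sum_ne_top.2 fun n _ => ENNReal.rpow_ne_top_of_nonneg hs0.le (hxt n)
  -- The extremal sequence in Hölder, truncated to F so that its normalization T is finite. As st +
  -- 1 = s, testing on it gives T^(1-t) ≤ K.
  set a : ι → ℝ≥0∞ := fun n => if n ∈ F then x n ^ s / T else 0 with ha
  have hsum : ∀ g : ι → ℝ≥0∞, ∑' n, (if n ∈ F then g n else 0) = ∑ n ∈ F, g n := fun g => by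
    rw [tsum_eq_sum (s := F) fun n hn => by simp [hn]]
    exact Finset.sum_congr rfl fun n hn => by simp [hn]
  have ha1 : ∑' n, a n ≤ 1 := by
    rw [ha, hsum]
    simp_rw [div_eq_mul_inv]
    rw [← Finset.sum_mul, ← hT, ENNReal.mul_inv_cancel hT0 hTt]
  have h2 := h a ha1
  have h3 : ∀ n, a n ^ t * x n = if n ∈ F then x n ^ s / T ^ t else 0 := fun n => by
    by_cases hn : n ∈ F
    · simp only [ha, hn, if_true]
      rw [ENNReal.div_rpow_of_nonneg _ _ ht.le, ← ENNReal.rpow_mul, div_eq_mul_inv,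
        mul_right_comm, div_eq_mul_inv]
      congr 1
      nth_rewrite 2 [← ENNReal.rpow_one (x n)]
      rw [← ENNReal.rpow_add_of_nonneg _ _ (by positivity) zero_le_one]
      congr 1
      rw [hs]; field_simp; ring
    · simp [ha, hn, ht]
  simp_rw [h3] at h2
  rw [hsum] at h2
  simp_rw [div_eq_mul_inv] at h2
  rw [← Finset.sum_mul, ← hT, ← ENNReal.rpow_neg] at h2
  nth_rewrite 1 [← ENNReal.rpow_one T] at h2
  rw [← ENNReal.rpow_add _ _ hT0 hTt, ← sub_eq_add_neg] at h2
  calc T = (T ^ (1 - t)) ^ s := by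
        rw [← ENNReal.rpow_mul, hs, mul_one_div_cancel h1t.ne', ENNReal.rpow_one]
    _ ≤ K ^ s := by gcongr

/-! ### Characterization of Carleson measures -/

/-- The averages of `μ` over unit discs are controlled by its masses near lattice points. -/
lemma Regular.exists_ratio_le {ν : Measure ℂ} (h : Regular ν) (μ : Measure ℂ) {t : ℝ} (ht : 0 < t) :
    ∃ M : ℝ≥0∞, M ≠ ∞ ∧ ∀ n u, dist u (lat n) < 1 → ratio μ ν u ≤
      M * (μ (Metric.ball (lat n) 3) / ν (Metric.ball (lat n) 1) ^ t) *
        ν (Metric.ball u 1) ^ (t - 1) := by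
  obtain ⟨M, hM, hV⟩ := h.exists_ball_le 1
  refine ⟨M ^ t, ENNReal.rpow_ne_top_of_nonneg ht.le hM, fun n u hu => ?_⟩
  have hu0 := h.ne_zero u
  have hut := h.ne_top u
  set v := ν (Metric.ball u 1) with hv
  set V := ν (Metric.ball (lat n) 1) with hVn
  have hVt0 : V ^ t ≠ 0 := by simp [ENNReal.rpow_eq_zero_iff, hVn, h.ne_zero, h.ne_top]
  have hVtt : V ^ t ≠ ∞ := ENNReal.rpow_ne_top_of_nonneg ht.le (h.ne_top _)
  have h1 : μ (Metric.ball u 1) ≤ μ (Metric.ball (lat n) 3) :=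
    measure_mono (Metric.ball_subset_ball' (by linarith))
  have h2 : V ^ t ≤ M ^ t * v ^ t := by
    rw [← ENNReal.mul_rpow_of_nonneg _ _ ht.le]
    gcongr
    exact hV _ _ (by rw [dist_comm]; exact hu.le)
  rw [ratio, ENNReal.rpow_sub _ _ hu0 hut, ENNReal.rpow_one]
  refine ENNReal.div_le_of_le_mul ?_
  rw [mul_assoc, ENNReal.div_mul_cancel hu0 hut]
  calc μ (Metric.ball u 1) ≤ μ (Metric.ball (lat n) 3) := h1
    _ = μ (Metric.ball (lat n) 3) / V ^ t * V ^ t := by rw [ENNReal.div_mul_cancel hVt0 hVtt]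
    _ ≤ μ (Metric.ball (lat n) 3) / V ^ t * (M ^ t * v ^ t) := by gcongr
    _ = _ := by ring

section Characterization

variable {μ ν : Measure ℂ} [SFinite μ] [SFinite ν] {α p q : ℝ}

/-- `q`-Carleson measures for the weighted Fock space of exponent `p ≤ q`. -/
theorem Regular.carleson_iff_of_le (h : Regular ν) (hα : 0 < α) (hp : 0 < p) (hpq : p ≤ q) :
    (∀ f : ℂ → ℂ, Differentiable ℂ f → ∫⁻ z, gauss α f z ^ p ∂ν < ∞ →
      ∫⁻ z, gauss α f z ^ q ∂μ < ∞) ↔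
    ∃ C : ℝ, 0 < C ∧ ∀ u,
      ratio μ ν u ≤ ENNReal.ofReal C * ν (Metric.ball u 1) ^ ((q - p) / p) := by
  have hq : 0 < q := hp.trans_le hpq
  have ht : 0 < q / p := div_pos hq hp
  constructor
  · intro hcar
    obtain ⟨K, hK, hKb⟩ := exists_tsum_rpow_mul_le ht fun a ha =>
      h.tsum_rpow_mul_ne_top hα hp hq hcar ha
    obtain ⟨M, hM, hMb⟩ := h.exists_ratio_le μ ht
    have hMK : M * K ≠ ∞ := ENNReal.mul_ne_top hM hK
    refine ⟨(M * K).toReal + 1, by positivity, fun u => ?_⟩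
    obtain ⟨n, hn⟩ := exists_dist_lat_lt u
    have hexp : (q - p) / p = q / p - 1 := by field_simp
    rw [hexp]
    refine (hMb n u hn).trans ?_
    gcongr
    refine (mul_le_mul_right (le_of_tsum_rpow_mul_le hKb n) M).trans ?_
    rw [ENNReal.le_ofReal_iff_toReal_le hMK (by positivity)]
    linarith
  · rintro ⟨C, -, hC⟩ f hf hfp
    exact h.lintegral_gauss_lt_top_of_le hα hp hpq ENNReal.ofReal_ne_top hC hf hfp

/-- `q`-Carleson measures for the weighted Fock space of exponent `p > q`. -/
theorem Regular.carleson_iff_of_lt (h : Regular ν) (hα : 0 < α) (hq : 0 < q) (hqp : q < p) :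
    (∀ f : ℂ → ℂ, Differentiable ℂ f → ∫⁻ z, gauss α f z ^ p ∂ν < ∞ →
      ∫⁻ z, gauss α f z ^ q ∂μ < ∞) ↔
    MemLp (ratio μ ν) (ENNReal.ofReal (p / (p - q))) ν := by
  have hp : 0 < p := hq.trans hqp
  have hsub : 0 < p - q := sub_pos.2 hqp
  have ht : 0 < q / p := div_pos hq hp
  have ht1 : q / p < 1 := (div_lt_one hp).2 hqp
  have hs : 0 < p / (p - q) := div_pos hp hsub
  have hmem : MemLp (ratio μ ν) (ENNReal.ofReal (p / (p - q))) ν ↔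
      ∫⁻ u, ratio μ ν u ^ (p / (p - q)) ∂ν < ∞ := by
    rw [MemLp, and_iff_right (measurable_ratio μ ν).aestronglyMeasurable,
      eLpNorm_lt_top_iff_lintegral_rpow_enorm_lt_top (by simpa using hs) ENNReal.ofReal_ne_top,
      ENNReal.toReal_ofReal hs.le]
    simp only [enorm_eq_self]
  rw [hmem]
  constructor
  · intro hcar
    obtain ⟨K, hK, hKb⟩ := exists_tsum_rpow_mul_le ht fun a ha =>
      h.tsum_rpow_mul_ne_top hα hp hq hcar ha
    obtain ⟨M, hM, hMb⟩ := h.exists_ratio_le μ ht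
    obtain ⟨D, hD, hDb⟩ := h.exists_ball_le 1
    have hexp : 1 / (1 - q / p) = p / (p - q) := by field_simp
    have hsum := tsum_rpow_le_of_tsum_rpow_mul_le ht ht1 hK hKb
    rw [hexp] at hsum
    set s := p / (p - q) with hs_def
    set x : ℤ × ℤ → ℝ≥0∞ :=
      fun n => μ (Metric.ball (lat n) 3) / ν (Metric.ball (lat n) 1) ^ (q / p) with hx
    have hMs : M ^ s * D ≠ ∞ := ENNReal.mul_ne_top (ENNReal.rpow_ne_top_of_nonneg hs.le hM) hD
    have hball : ∀ n, ∫⁻ u in Metric.ball (lat n) 1, ratio μ ν u ^ s ∂ν ≤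
        M ^ s * D * x n ^ s := by
      intro n
      have hpt : ∀ u ∈ Metric.ball (lat n) 1, ratio μ ν u ^ s ≤
          M ^ s * D * x n ^ s * (ν (Metric.ball (lat n) 1))⁻¹ := by
        intro u hu
        -- Since (q/p - 1)·p/(p-q) = -1, integrating over a unit disc cancels the ν-mass and leaves
        -- a multiple of x_n^s.
        have h1 : (ν (Metric.ball u 1) ^ (q / p - 1)) ^ s = (ν (Metric.ball u 1))⁻¹ := by
          rw [← ENNReal.rpow_mul, ← ENNReal.rpow_neg_one]
          congr 1
          rw [hs_def]; field_simp; ring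
        have h2 : (ν (Metric.ball u 1))⁻¹ ≤ D * (ν (Metric.ball (lat n) 1))⁻¹ := by
          rw [← div_eq_mul_inv, ENNReal.le_div_iff_mul_le (Or.inl (h.ne_zero _))
            (Or.inl (h.ne_top _)), mul_comm, ← div_eq_mul_inv]
          exact ENNReal.div_le_of_le_mul
            (hDb _ _ (by rw [dist_comm]; exact (Metric.mem_ball.1 hu).le))
        calc ratio μ ν u ^ s ≤ (M * x n * ν (Metric.ball u 1) ^ (q / p - 1)) ^ s := by
              gcongr; exact hMb n u hu
          _ = M ^ s * x n ^ s * (ν (Metric.ball u 1))⁻¹ := by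
              rw [ENNReal.mul_rpow_of_nonneg _ _ hs.le, ENNReal.mul_rpow_of_nonneg _ _ hs.le, h1]
          _ ≤ M ^ s * x n ^ s * (D * (ν (Metric.ball (lat n) 1))⁻¹) := by gcongr
          _ = _ := by ring
      refine (setLIntegral_mono' Metric.isOpen_ball.measurableSet hpt).trans ?_
      rw [setLIntegral_const, mul_assoc (M ^ s * D * x n ^ s),
        ENNReal.inv_mul_cancel (h.ne_zero _) (h.ne_top _), mul_one]
    have hcov : (⋃ n, Metric.ball (lat n) 1) = Set.univ :=
      Set.eq_univ_of_forall fun z => Set.mem_iUnion.2 (exists_dist_lat_lt z)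
    rw [← setLIntegral_univ, ← hcov]
    calc ∫⁻ u in ⋃ n, Metric.ball (lat n) 1, ratio μ ν u ^ s ∂ν
        ≤ ∑' n, ∫⁻ u in Metric.ball (lat n) 1, ratio μ ν u ^ s ∂ν := lintegral_iUnion_le _ _
      _ ≤ ∑' n, M ^ s * D * x n ^ s := ENNReal.tsum_le_tsum hball
      _ ≤ M ^ s * D * K ^ s := by rw [ENNReal.tsum_mul_left]; gcongr
      _ < ∞ := (ENNReal.mul_ne_top hMs (ENNReal.rpow_ne_top_of_nonneg hs.le hK)).lt_top
  · intro hG f hf hfp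
    exact h.lintegral_gauss_lt_top_of_lt hα hq hqp hG hf hfp

end Characterization

/-! ### From multipliers to Carleson measures -/

lemma ofReal_norm_rpow_mul_exp {α p : ℝ} (hp : 0 < p) (f : ℂ → ℂ) (z : ℂ) :
    ENNReal.ofReal (‖f z‖ ^ p * Real.exp (-p * (α / 2) * ‖z‖ ^ 2)) = gauss α f z ^ p := by
  rw [gauss, ← ofReal_norm, ← ENNReal.ofReal_mul (norm_nonneg _),
    ENNReal.ofReal_rpow_of_nonneg (by positivity) hp.le,
    Real.mul_rpow (norm_nonneg _) (Real.exp_pos _).le, ← Real.exp_mul]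
  congr 3; ring

lemma mem_fock_iff {ω : ℂ → ℝ} (hω : IsWeight ω) {p α : ℝ} (hp : 0 < p) (f : ℂ → ℂ) :
    f ∈ fock p α ω ↔ Differentiable ℂ f ∧ ∫⁻ z, gauss α f z ^ p ∂(wMeasure ω) < ∞ := by
  have h1 : ∫⁻ z, gauss α f z ^ p ∂(wMeasure ω) =
      ∫⁻ z, ENNReal.ofReal (‖f z‖ ^ p * Real.exp (-p * (α / 2) * ‖z‖ ^ 2) * ω z) := by
    rw [← setLIntegral_univ, hω.setLIntegral_wMeasure MeasurableSet.univ, setLIntegral_univ]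
    refine lintegral_congr fun z => ?_
    rw [ENNReal.ofReal_mul (by positivity), ofReal_norm_rpow_mul_exp hp, mul_comm]
  rw [h1]
  constructor
  · rintro ⟨⟨-, h⟩, hf⟩
    exact ⟨hf, h⟩
  · rintro ⟨hf, h⟩
    exact ⟨⟨hf.continuous.aestronglyMeasurable, h⟩, hf⟩

/-- The density `|g|^q exp(-q (β - α)/2 |z|²) η`. -/
def multDensity (q α β : ℝ) (η : ℂ → ℝ) (g : ℂ → ℂ) (z : ℂ) : ℝ :=
  ‖g z‖ ^ q * Real.exp (-q * ((β - α) / 2) * ‖z‖ ^ 2) * η z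

lemma isWeight_multDensity {q α β : ℝ} (hq : 0 < q) {η : ℂ → ℝ} (hη : IsWeight η) {g : ℂ → ℂ}
    (hg : Continuous g) : IsWeight (multDensity q α β η g) := by
  refine ⟨fun z => mul_nonneg (by positivity) (hη.1 z), ?_⟩
  have hc : Continuous fun z => ‖g z‖ ^ q * Real.exp (-q * ((β - α) / 2) * ‖z‖ ^ 2) :=
    (hg.norm.rpow_const fun _ => Or.inr hq.le).mul (by fun_prop)
  exact hη.2.continuous_smul hc

lemma avg_eq_ratio (q α β : ℝ) (ω η : ℂ → ℝ) (g : ℂ → ℂ) :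
    avg q α β ω η g = ratio (wMeasure (multDensity q α β η g)) (wMeasure ω) := by
  funext u
  rw [avg, ratio]
  congr 1
  exact (withDensity_apply _ Metric.isOpen_ball.measurableSet).symm

/-- The Gaussian of parameter β is the product of those of parameters β - α, absorbed into the
measure, and α, left with f. -/
lemma mul_mem_fock_iff {q α β : ℝ} (hq : 0 < q) {η : ℂ → ℝ} (hη : IsWeight η) {f g : ℂ → ℂ}
    (hg : Differentiable ℂ g) (hf : Differentiable ℂ f) :
    (fun z => g z * f z) ∈ fock q β η ↔
      ∫⁻ z, gauss α f z ^ q ∂(wMeasure (multDensity q α β η g)) < ∞ := by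
  have h1 : ∫⁻ z, gauss β (fun z => g z * f z) z ^ q ∂(wMeasure η) =
      ∫⁻ z, gauss α f z ^ q ∂(wMeasure (multDensity q α β η g)) := by
    rw [← setLIntegral_univ, hη.setLIntegral_wMeasure MeasurableSet.univ, setLIntegral_univ,
      ← setLIntegral_univ (fun z => gauss α f z ^ q),
      (isWeight_multDensity hq hη hg.continuous).setLIntegral_wMeasure MeasurableSet.univ,
      setLIntegral_univ]
    refine lintegral_congr fun z => ?_
    rw [← ofReal_norm_rpow_mul_exp hq, ← ofReal_norm_rpow_mul_exp hq, multDensity,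
      ← ENNReal.ofReal_mul (hη.1 z), ← ENNReal.ofReal_mul
        (mul_nonneg (by positivity) (hη.1 z)), norm_mul,
      Real.mul_rpow (norm_nonneg _) (norm_nonneg _),
      show -q * (β / 2) * ‖z‖ ^ 2 = -q * ((β - α) / 2) * ‖z‖ ^ 2 + -q * (α / 2) * ‖z‖ ^ 2 by ring,
      Real.exp_add]
    congr 1; ring
  rw [mem_fock_iff hη hq, h1, and_iff_right (hg.fun_mul hf)]

lemma mem_mult_iff {p q α β : ℝ} (hp : 0 < p) (hq : 0 < q) {ω η : ℂ → ℝ} (hω : IsWeight ω)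
    (hη : IsWeight η) {g : ℂ → ℂ} (hg : Differentiable ℂ g) :
    g ∈ mult (fock p α ω) (fock q β η) ↔
      ∀ f : ℂ → ℂ, Differentiable ℂ f → ∫⁻ z, gauss α f z ^ p ∂(wMeasure ω) < ∞ →
        ∫⁻ z, gauss α f z ^ q ∂(wMeasure (multDensity q α β η g)) < ∞ := by
  constructor
  · intro h f hf hfp
    exact (mul_mem_fock_iff hq hη hg hf).1 (h f ((mem_fock_iff hω hp f).2 ⟨hf, hfp⟩))
  · intro h f hf
    obtain ⟨hfd, hfp⟩ := (mem_fock_iff hω hp f).1 hf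
    exact (mul_mem_fock_iff hq hη hg hfd).2 (h f hfd hfp)

lemma fock_subset_iff_one_mem_mult (p q α β : ℝ) (ω η : ℂ → ℝ) :
    fock p α ω ⊆ fock q β η ↔ (fun _ => 1) ∈ mult (fock p α ω) (fock q β η) := by
  change (∀ f ∈ fock p α ω, f ∈ fock q β η) ↔
    ∀ f ∈ fock p α ω, (fun z => 1 * f z) ∈ fock q β η
  simp only [one_mul]

instance (ω : ℂ → ℝ) : SFinite (wMeasure ω) := by
  unfold wMeasure
  infer_instance

end WeightedFock

end

open WeightedFock

theorem mainTheorem4 (p q α β : ℝ) (hp : 0 < p) (hq : 0 < q) (hα : 0 < α) (hβ : 0 < β)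
    (ω η : ℂ → ℝ) (hω : IsAInftyRestricted ω) (hη : IsWeight η) :
    -- pointwise multipliers
    (∀ g ∈ fock q β η,
      (p ≤ q → (g ∈ mult (fock p α ω) (fock q β η) ↔
        ∃ C : ℝ, 0 < C ∧ ∀ u : ℂ,
          avg q α β ω η g u ≤
            ENNReal.ofReal C * wMeasure ω (Metric.ball u 1) ^ ((q - p) / p))) ∧
      (q < p → (g ∈ mult (fock p α ω) (fock q β η) ↔
        MemLp (avg q α β ω η g) (ENNReal.ofReal (p / (p - q))) (wMeasure ω)))) ∧
    -- embeddings
    (p ≤ q → (fock p α ω ⊆ fock q β η ↔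
      ∃ C : ℝ, 0 < C ∧ ∀ u : ℂ,
        avg q α β ω η (fun _ => 1) u ≤
          ENNReal.ofReal C * wMeasure ω (Metric.ball u 1) ^ ((q - p) / p))) ∧
    (q < p → (fock p α ω ⊆ fock q β η ↔
      MemLp (avg q α β ω η (fun _ => 1)) (ENNReal.ofReal (p / (p - q))) (wMeasure ω))) := by
  have hw := hω.isWeight.1
  have hr := hω.regular
  -- Stated for all entire g, so that it also covers g = 1 outside the target space.
  have key : ∀ g : ℂ → ℂ, Differentiable ℂ g →
      (p ≤ q → (g ∈ mult (fock p α ω) (fock q β η) ↔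
        ∃ C : ℝ, 0 < C ∧ ∀ u : ℂ, avg q α β ω η g u ≤
          ENNReal.ofReal C * wMeasure ω (Metric.ball u 1) ^ ((q - p) / p))) ∧
      (q < p → (g ∈ mult (fock p α ω) (fock q β η) ↔
        MemLp (avg q α β ω η g) (ENNReal.ofReal (p / (p - q))) (wMeasure ω))) := by
    intro g hg
    rw [mem_mult_iff hp hq hw hη hg, avg_eq_ratio]
    exact ⟨hr.carleson_iff_of_le hα hp, hr.carleson_iff_of_lt hα hq⟩
  refine ⟨fun g hg => key g hg.2, ?_⟩
  rw [fock_subset_iff_one_mem_mult]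
  exact key _ (differentiable_const 1)
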